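/- Let $G$ be a finite group, $\mathbb K$ a field, and $(V,\varrho)$ a $\mathbb K$-linear representation of $G$. For $n\ge 0$ put $C_n=\{[1],\dots,[n]\}$ and $$C^n_G(V,V)=\mathrm{Hom}_{\mathrm{Rep}(G)}(\mathbb K[C_n]\otimes V^{\otimes n},V),\qquad E(n)=\mathrm{Hom}_{\mathrm{Rep}(G)}(V^{\otimes n},V),$$ where $G$ acts trivially on $\mathbb K[C_n]$; thus $C^0_G(V,V)=0$ and $E(0)=V^G$. Write $f_{[r]}=f([r];-)$ for $f\in C^n_G(V,V)$. For $\phi\in E(m)$, $\psi\in E(n)$ and $1\le i\le m$ let $(\phi\circ_i\psi)(a_1,\dots,a_{m+n-1})=\phi(a_1,\dots,a_{i-1},\psi(a_i,\dots,a_{i+n-1}),a_{i+n},\dots,a_{m+n-1})$. For $f\in C^m_G(V,V)$, $g\in C^n_G(V,V)$ and $1\le i\le m$ let $$(f\circ_i g)([r];a_1,\dots,a_{m+n-1})=f\big(R_0[r];a_1,\dots,a_{i-1},g(R_i[r];a_i,\dots,a_{i+n-1}),a_{i+n},\dots,a_{m+n-1}\big),$$ where $R_0[r]=[r]$ for $r\le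 i-1$, $R_0[r]=[i]$ for $i\le r\le i+n-1$, $R_0[r]=[r-n+1]$ for $r\ge i+n$, and $R_i[r]=[r-i+1]$ for $i\le r\le i+n-1$, $R_i[r]=[1]+\dots+[n]$ otherwise. With these partial compositions, and with the identity of $V$ as identity element, both collections are non-symmetric operads. **(1)** The maps $S_n:C^n_G(V,V)\to E(n)$, $f\mapsto f_{[1]}+\dots+f_{[n]}$, form a morphism of operads. **(2)** Let $(V,\prec,\succ)$ be a dendriform algebra in $\mathrm{Rep}(G)$, that is, $\prec,\succ:V\times V\to V$ are $G$-equivariant bilinear maps with $(a\prec b)\prec c=a\prec(b\prec c+b\succ c)$, $(a\succ b)\prec c=a\succ(b\prec c)$ and $(a\prec b+a\succ b)\succ c=a\succ(b\succ c)$. Let $\pi\in C^2_G(V,V)$ be given by $\pi_{[1]}=\prec$, $\pi_{[2]}=\succ$, and let $\mu\in E(2)$ be the associative product $\prec+\succ$; both satisfy $\pi\circ_1\pi=\pi\circ_2\pi$. Then $S_2(\pi)=\mu$. **(3)** For each of these two operads with multiplication, let (with $\pi$ denoting the multiplication and $f,g$ elements of arity $m,n$) $$\delta f=\pi\circ_2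 f+\sum_{i=1}^{m}(-1)^i f\circ_i\pi+(-1)^{m+1}\pi\circ_1 f,\qquad f\cup g=(\pi\circ_2 g)\circ_1 f,$$ $$[f,g]=\sum_{i=1}^m(-1)^{(i-1)(n-1)}f\circ_i g-(-1)^{(m-1)(n-1)}\sum_{i=1}^n(-1)^{(i-1)(m-1)}g\circ_i f .$$ Then $\delta^2=0$. Denote the cohomologies of the two complexes by $H^*_G(V,V)$ and $H^*_{\mathrm{Hoch}}(V,V)$ respectively. The operations $\cup$ and $[\,,]$ induce on each of these graded spaces the structure of a Gerstenhaber algebra: $\cup$ is associative and graded commutative of degree $0$; $[\,,]$ has degree $-1$ and is a graded Lie bracket for the shifted degree $|x|-1$; and $[x\cup y,z]=[x,z]\cup y+(-1)^{|x|(|z|-1)}x\cup[y,z]$ for homogeneous $x,y,z$. The maps $S_n$ commute with $\delta$, hence induce linear maps $S_*:H^n_G(V,V)\to H^n_{\mathrm{Hoch}}(V,V)$, and $S_*$ is a morphism of Gerstenhaber algebras, i.e. it preserves $\cup$ and $[\,,]$. -/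

import Mathlib

noncomputable section

namespace EquivDend

open scoped DirectSum

universe u v w

/-- A non-symmetric `K`-linear operad in the partial-composition form, arities in `ℕ`.
`comp h i f g` is the partial composition of `f` and `g` at input `i` (inputs are counted
from `0`); the arity `k = m + n - 1` of the result is recorded by `h : m + n = k + 1`. -/
structure NSOperad (K : Type u) [Field K] where
  carrier : ℕ → Type v
  [addCommGroup : ∀ n, AddCommGroup (carrier n)]
  [module : ∀ n, Module K (carrier n)]
  comp : ∀ {m n k : ℕ}, m + n = k + 1 → Fin m → carrier m →ₗ[K] carrier n →ₗ[K] carrier k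
  one : carrier 1
  one_comp : ∀ {n : ℕ} (h : 1 + n = n + 1) (f : carrier n), comp h 0 one f = f
  comp_one : ∀ {n : ℕ} (i : Fin n) (f : carrier n), comp rfl i f one = f
  comp_seq : ∀ {m n p a b c : ℕ} (h₁ : m + n = a + 1) (h₂ : a + p = c + 1) (h₃ : n + p = b + 1)
    (h₄ : m + b = c + 1) (i : Fin m) (j : Fin n) (f : carrier m) (g : carrier n) (e : carrier p),
    comp h₂ ⟨i + j, by omega⟩ (comp h₁ i f g) e = comp h₄ i f (comp h₃ j g e)
  comp_par : ∀ {m n p a b c : ℕ} (h₁ : m + n = a + 1) (h₂ : a + p = c + 1) (h₃ : m + p = b + 1)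
    (h₄ : b + n = c + 1) (i k : Fin m) (_ : i.val < k.val) (f : carrier m) (g : carrier n)
    (e : carrier p),
    comp h₂ ⟨k + n - 1, by omega⟩ (comp h₁ i f g) e = comp h₄ ⟨i, by omega⟩ (comp h₃ k f e) g

attribute [instance] NSOperad.addCommGroup NSOperad.module

/-- A family of linear maps is a morphism of operads if it preserves the identity element and
all partial compositions. -/
structure IsOperadHom {K : Type u} [Field K] (P : NSOperad.{u, v} K) (Q : NSOperad.{u, w} K)
    (F : ∀ n, P.carrier n →ₗ[K] Q.carrier n) : Prop where
  map_one : F 1 P.one = Q.one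
  map_comp : ∀ {m n k : ℕ} (h : m + n = k + 1) (i : Fin m) (f : P.carrier m) (g : P.carrier n),
    F k (P.comp h i f g) = Q.comp h i (F m f) (F n g)

namespace NSOperad

variable {K : Type u} [Field K] (P : NSOperad.{u, v} K)

/-- A multiplication on an operad: an element `π` of arity two with `π ∘₁ π = π ∘₂ π`. -/
structure Multiplication where
  val : P.carrier 2
  assoc : P.comp (rfl : 2 + 2 = 3 + 1) 0 val val = P.comp (rfl : 2 + 2 = 3 + 1) 1 val val

/-- The circle product `f ∘ g = ∑ᵢ (-1)^((i-1)(n-1)) f ∘ᵢ g`, with `i` counted from `1`. Here `i`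
is counted from `0`, and `n - 1` is replaced by `n + 1`, which has the same parity. -/
def circ {m n k : ℕ} (h : m + n = k + 1) (f : P.carrier m) (g : P.carrier n) : P.carrier k :=
  ∑ i : Fin m, (-1 : K) ^ (i.val * (n + 1)) • P.comp h i f g

/-- The Gerstenhaber bracket `[f, g] = f ∘ g - (-1)^((m-1)(n-1)) g ∘ f`. -/
def bracket {m n k : ℕ} (h : m + n = k + 1) (f : P.carrier m) (g : P.carrier n) : P.carrier k :=
  P.circ h f g - (-1 : K) ^ ((m + 1) * (n + 1)) • P.circ (by omega : n + m = k + 1) g f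

variable {P} (π : P.Multiplication)

namespace Multiplication

/-- The cup product `f ∪ g = (π ∘₂ g) ∘₁ f`, informally `π(f, g)`. -/
def cup {m n k : ℕ} (h : m + n = k) (f : P.carrier m) (g : P.carrier n) : P.carrier k :=
  P.comp (by omega : (n + 1) + m = k + 1) 0
    (P.comp (by omega : 2 + n = (n + 1) + 1) 1 π.val g) f

/-- The coboundary `δ f = π ∘₂ f + ∑ᵢ (-1)^i f ∘ᵢ π + (-1)^(n+1) π ∘₁ f`, with `i = 1, …, n`
(in the code `i` is counted from `0`). -/
def delta (n : ℕ) : P.carrier n →ₗ[K] P.carrier (n + 1) :=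
  P.comp (by omega : 2 + n = (n + 1) + 1) 1 π.val
    + ∑ i : Fin n, (-1 : K) ^ (i.val + 1) • (P.comp (rfl : n + 2 = (n + 1) + 1) i).flip π.val
    + (-1 : K) ^ (n + 1) • P.comp (by omega : 2 + n = (n + 1) + 1) 0 π.val

/-- The `n`-cocycles. -/
abbrev cocycles (n : ℕ) : Submodule K (P.carrier n) := LinearMap.ker (π.delta n)

/-- The `n`-coboundaries (zero for `n = 0`). -/
def coboundaries : (n : ℕ) → Submodule K (P.carrier n)
  | 0 => ⊥
  | n + 1 => LinearMap.range (π.delta n)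

/-- The `n`-th cohomology induced by a multiplication: cocycles modulo coboundaries. -/
abbrev cohomology (n : ℕ) : Type v :=
  π.cocycles n ⧸ (π.coboundaries n).submoduleOf (π.cocycles n)

/-- The cohomology class of a cocycle. -/
def cls (n : ℕ) : π.cocycles n →ₗ[K] π.cohomology n := Submodule.mkQ _

/-- The class of a cocycle in the total cohomology. -/
def totalCls (n : ℕ) : π.cocycles n →ₗ[K] ⨁ n, π.cohomology n :=
  DirectSum.lof K ℕ π.cohomology n ∘ₗ π.cls n

end Multiplication

end NSOperad

/-- A Gerstenhaber algebra structure on the graded vector space `⨁ n, H n`: a graded commutative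
associative product of degree `0` and a graded Lie bracket of degree `-1` (a Lie bracket for the
shifted degree `|x| - 1`), such that bracketing is a graded derivation of the product:
`[x y, z] = [x, z] y + (-1)^(|x| (|z| - 1)) x [y, z]`, which is Gerstenhaber's sign convention.
In exponents of `-1`, `n - 1` is written as `n + 1`. -/
structure GerstenhaberAlgebra (K : Type u) [Field K] (H : ℕ → Type v)
    [∀ n, AddCommGroup (H n)] [∀ n, Module K (H n)] where
  mul : (⨁ n, H n) →ₗ[K] (⨁ n, H n) →ₗ[K] (⨁ n, H n)
  bracket : (⨁ n, H n) →ₗ[K] (⨁ n, H n) →ₗ[K] (⨁ n, H n)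
  mul_degree : ∀ (m n : ℕ) (x : H m) (y : H n),
    mul (.lof K ℕ H m x) (.lof K ℕ H n y) ∈ LinearMap.range (DirectSum.lof K ℕ H (m + n))
  bracket_degree : ∀ (m n k : ℕ) (_ : m + n = k + 1) (x : H m) (y : H n),
    bracket (.lof K ℕ H m x) (.lof K ℕ H n y) ∈ LinearMap.range (DirectSum.lof K ℕ H k)
  bracket_degree_zero : ∀ x y : H 0, bracket (.lof K ℕ H 0 x) (.lof K ℕ H 0 y) = 0
  mul_assoc : ∀ x y z, mul (mul x y) z = mul x (mul y z)
  mul_comm : ∀ (m n : ℕ) (x : H m) (y : H n),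
    mul (.lof K ℕ H m x) (.lof K ℕ H n y)
      = (-1 : K) ^ (m * n) • mul (.lof K ℕ H n y) (.lof K ℕ H m x)
  bracket_skew : ∀ (m n : ℕ) (x : H m) (y : H n),
    bracket (.lof K ℕ H m x) (.lof K ℕ H n y)
      = -((-1 : K) ^ ((m + 1) * (n + 1)) • bracket (.lof K ℕ H n y) (.lof K ℕ H m x))
  jacobi : ∀ (m n p : ℕ) (x : H m) (y : H n) (z : H p),
    bracket (.lof K ℕ H m x) (bracket (.lof K ℕ H n y) (.lof K ℕ H p z))
      = bracket (bracket (.lof K ℕ H m x) (.lof K ℕ H n y)) (.lof K ℕ H p z)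
        + (-1 : K) ^ ((m + 1) * (n + 1)) •
          bracket (.lof K ℕ H n y) (bracket (.lof K ℕ H m x) (.lof K ℕ H p z))
  leibniz : ∀ (m n p : ℕ) (x : H m) (y : H n) (z : H p),
    bracket (mul (.lof K ℕ H m x) (.lof K ℕ H n y)) (.lof K ℕ H p z)
      = mul (bracket (.lof K ℕ H m x) (.lof K ℕ H p z)) (.lof K ℕ H n y)
        + (-1 : K) ^ (m * (p + 1)) •
          mul (.lof K ℕ H m x) (bracket (.lof K ℕ H n y) (.lof K ℕ H p z))

namespace GerstenhaberAlgebra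

variable {K : Type u} [Field K]

/-- The Gerstenhaber algebra structure is the one induced on the cohomology of a multiplication
by the cup product and the Gerstenhaber bracket of cocycles. -/
structure IsInducedBy {P : NSOperad.{u, v} K} {π : P.Multiplication}
    (A : GerstenhaberAlgebra K π.cohomology) : Prop where
  mul_cls : ∀ (m n k : ℕ) (h : m + n = k) (f : π.cocycles m) (g : π.cocycles n),
    ∃ hc : π.cup h f.val g.val ∈ π.cocycles k,
      A.mul (π.totalCls m f) (π.totalCls n g) = π.totalCls k ⟨π.cup h f.val g.val, hc⟩
  bracket_cls : ∀ (m n k : ℕ) (h : m + n = k + 1) (f : π.cocycles m) (g : π.cocycles n),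
    ∃ hc : P.bracket h f.val g.val ∈ π.cocycles k,
      A.bracket (π.totalCls m f) (π.totalCls n g) = π.totalCls k ⟨P.bracket h f.val g.val, hc⟩

/-- A family of linear maps is a morphism of Gerstenhaber algebras if the induced degree
preserving map on the total spaces preserves the product and the bracket. -/
structure IsHom {H : ℕ → Type v} [∀ n, AddCommGroup (H n)] [∀ n, Module K (H n)]
    {L : ℕ → Type w} [∀ n, AddCommGroup (L n)] [∀ n, Module K (L n)]
    (A : GerstenhaberAlgebra K H) (B : GerstenhaberAlgebra K L)
    (φ : ∀ n, H n →ₗ[K] L n) : Prop where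
  map_mul : ∀ x y, DirectSum.lmap φ (A.mul x y)
    = B.mul (DirectSum.lmap φ x) (DirectSum.lmap φ y)
  map_bracket : ∀ x y, DirectSum.lmap φ (A.bracket x y)
    = B.bracket (DirectSum.lmap φ x) (DirectSum.lmap φ y)

end GerstenhaberAlgebra

section Multilinear

variable {K : Type u} [Field K] {V : Type v} [AddCommGroup V] [Module K V]

/-- The arguments `(v₀, …, v_{i-1}, g(v_i, …, v_{i+n-1}), v_{i+n}, …)`, for `v` of length
`k = m + n - 1`. -/
def insertArgs {V : Type v} {m n k : ℕ} (h : m + n = k + 1) (i : Fin m) (g : (Fin n → V) → V)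
    (v : Fin k → V) : Fin m → V := fun j =>
  if _ : j.val < i.val then v ⟨j, by omega⟩
  else if _ : j.val = i.val then g fun l => v ⟨i + l, by omega⟩
  else v ⟨j + n - 1, by omega⟩

theorem insertArgs_update {m n k : ℕ} (h : m + n = k + 1) (i : Fin m)
    (g : MultilinearMap K (fun _ : Fin n => V) V) (v : Fin k → V) (p : Fin k) :
    (∃ q : Fin m, ∀ x, insertArgs h i g (Function.update v p x)
        = Function.update (insertArgs h i g v) q x) ∨
    (∃ q : Fin n, ∀ x, insertArgs h i g (Function.update v p x)
        = Function.update (insertArgs h i g v) i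
            (g (Function.update (fun l : Fin n => v ⟨i + l, by omega⟩) q x))) := by
  by_cases h1 : p.val < i.val
  · left
    refine ⟨⟨p, by omega⟩, fun x => ?_⟩
    funext j
    simp only [insertArgs, Function.update_apply, Fin.ext_iff]
    split_ifs <;> first | rfl | omega | skip
    congr 1; funext l
    rw [if_neg (by omega)]
  · by_cases h2 : p.val < i.val + n
    · right
      refine ⟨⟨p - i, by omega⟩, fun x => ?_⟩
      funext j
      simp only [insertArgs, Function.update_apply, Fin.ext_iff]
      split_ifs <;> first | rfl | omega | skip
      congr 1; funext l
      simp only [Function.update_apply, Fin.ext_iff]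
      congr 1
      exact propext ⟨fun _ => by omega, fun _ => by omega⟩
    · left
      refine ⟨⟨p + 1 - n, by omega⟩, fun x => ?_⟩
      funext j
      simp only [insertArgs, Function.update_apply, Fin.ext_iff]
      split_ifs <;> first | rfl | omega | skip
      congr 1; funext l
      rw [if_neg (by omega)]

/-- The partial composition `f(v₀, …, v_{i-1}, g(v_i, …, v_{i+n-1}), v_{i+n}, …)` of
multilinear maps. -/
def multComp {m n k : ℕ} (h : m + n = k + 1) (i : Fin m)
    (f : MultilinearMap K (fun _ : Fin m => V) V) (g : MultilinearMap K (fun _ : Fin n => V) V) :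
    MultilinearMap K (fun _ : Fin k => V) V where
  toFun v := f (insertArgs h i g v)
  map_update_add' {inst} v p x y := by
    have hd : inst = instDecidableEqFin k := Subsingleton.elim _ _
    rw [hd]
    rcases insertArgs_update h i g v p with ⟨q, hq⟩ | ⟨q, hq⟩
    · simp only [hq, MultilinearMap.map_update_add]
    · simp only [hq, MultilinearMap.map_update_add]
  map_update_smul' {inst} v p c x := by
    have hd : inst = instDecidableEqFin k := Subsingleton.elim _ _
    rw [hd]
    rcases insertArgs_update h i g v p with ⟨q, hq⟩ | ⟨q, hq⟩
    · simp only [hq, MultilinearMap.map_update_smul]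
    · simp only [hq, MultilinearMap.map_update_smul]

theorem insertArgs_eq_update {V : Type v} {m n k : ℕ} (h : m + n = k + 1) (i : Fin m)
    (g g' : (Fin n → V) → V) (v : Fin k → V) :
    insertArgs h i g v = Function.update (insertArgs h i g' v) i
      (g fun l => v ⟨i + l, by omega⟩) := by
  funext j
  simp only [insertArgs, Function.update_apply, Fin.ext_iff]
  split_ifs <;> first | rfl | omega

/-- Partial composition of multilinear maps, as a bilinear map. -/
def multCompL {m n k : ℕ} (h : m + n = k + 1) (i : Fin m) :
    MultilinearMap K (fun _ : Fin m => V) V →ₗ[K] MultilinearMap K (fun _ : Fin n => V) V →ₗ[K]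
      MultilinearMap K (fun _ : Fin k => V) V :=
  LinearMap.mk₂ K (multComp h i)
    (fun _ _ _ => rfl) (fun _ _ _ => rfl)
    (fun f g g' => by
      ext v
      simp only [multComp, MultilinearMap.coe_mk, add_apply]
      rw [insertArgs_eq_update h i _ g v, insertArgs_eq_update h i g' g v]
      conv_rhs => rw [insertArgs_eq_update h i g g v]
      simp)
    (fun c f g => by
      ext v
      simp only [multComp, MultilinearMap.coe_mk, smul_apply]
      rw [insertArgs_eq_update h i _ g v]
      conv_rhs => rw [insertArgs_eq_update h i g g v]
      simp)

theorem multComp_seq {m n p a b c : ℕ} (h₁ : m + n = a + 1) (h₂ : a + p = c + 1)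
    (h₃ : n + p = b + 1) (h₄ : m + b = c + 1) (i : Fin m) (j : Fin n)
    (f : MultilinearMap K (fun _ : Fin m => V) V) (g : MultilinearMap K (fun _ : Fin n => V) V)
    (e : MultilinearMap K (fun _ : Fin p => V) V) :
    multComp h₂ ⟨i + j, by omega⟩ (multComp h₁ i f g) e = multComp h₄ i f (multComp h₃ j g e) := by
  ext v
  simp only [multComp, MultilinearMap.coe_mk]
  congr 1; funext s
  simp only [insertArgs]
  split_ifs with h5 h6 h7 <;> first | rfl | omega | skip
  · congr 1; funext l
    simp only [insertArgs]
    split_ifs <;> first | rfl | omega | skip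
    · congr 1; funext l
      congr 1; simp only [Fin.mk.injEq]; omega
    · congr 1; simp only [Fin.mk.injEq]; omega
  · congr 1; simp only [Fin.mk.injEq]; omega

theorem multComp_par {m n p a b c : ℕ} (h₁ : m + n = a + 1) (h₂ : a + p = c + 1)
    (h₃ : m + p = b + 1) (h₄ : b + n = c + 1) (i k : Fin m) (hik : i.val < k.val)
    (f : MultilinearMap K (fun _ : Fin m => V) V) (g : MultilinearMap K (fun _ : Fin n => V) V)
    (e : MultilinearMap K (fun _ : Fin p => V) V) :
    multComp h₂ ⟨k + n - 1, by omega⟩ (multComp h₁ i f g) e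
      = multComp h₄ ⟨i, by omega⟩ (multComp h₃ k f e) g := by
  ext v
  simp only [multComp, MultilinearMap.coe_mk]
  congr 1; funext s
  simp only [insertArgs]
  split_ifs <;> first | rfl | omega | skip
  · congr 1; funext l
    rw [dif_pos (by omega)]
  · congr 1; funext l
    rw [dif_neg (by omega), dif_neg (by omega)]
    congr 1; simp only [Fin.mk.injEq]; omega
  · congr 1; simp only [Fin.mk.injEq]; omega
theorem multCompL_apply {m n k : ℕ} (h : m + n = k + 1) (i : Fin m)
    (f : MultilinearMap K (fun _ : Fin m => V) V) (g : MultilinearMap K (fun _ : Fin n => V) V) :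
    multCompL h i f g = multComp h i f g := rfl

theorem multComp_apply {m n k : ℕ} (h : m + n = k + 1) (i : Fin m)
    (f : MultilinearMap K (fun _ : Fin m => V) V) (g : MultilinearMap K (fun _ : Fin n => V) V)
    (v : Fin k → V) : multComp h i f g v = f (insertArgs h i g v) := rfl

/-- The identity of `V` as a multilinear map in one variable. -/
def multOne (K : Type u) [Field K] (V : Type v) [AddCommGroup V] [Module K V] :
    MultilinearMap K (fun _ : Fin 1 => V) V :=
  MultilinearMap.ofSubsingleton K V V 0 LinearMap.id

theorem multComp_one_left {n : ℕ} (h : 1 + n = n + 1)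
    (f : MultilinearMap K (fun _ : Fin n => V) V) : multComp h 0 (multOne K V) f = f := by
  ext v
  simp only [multComp_apply, multOne, insertArgs, MultilinearMap.ofSubsingleton_apply_apply,
    LinearMap.id_apply]
  simp only [Fin.val_zero, Nat.not_lt_zero, dite_false, Fin.val_eq_zero, dite_true]
  congr 1; funext l
  congr 1; ext; simp

theorem multComp_one_right {n : ℕ} (i : Fin n)
    (f : MultilinearMap K (fun _ : Fin n => V) V) : multComp rfl i f (multOne K V) = f := by
  ext v
  rw [multComp_apply]
  congr 1; funext j
  simp only [insertArgs, multOne]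
  split_ifs with h1 h2
  · rfl
  · obtain rfl : j = i := Fin.ext h2
    simp
  · congr 1

/-- The map `R₀(m; 1, …, n, …, 1) : C_k → C_m`, where `k = m + n - 1`, `n` is at place `i`, and the
elements of `C_n = Fin n` are counted from `0`. -/
def R₀ {m n k : ℕ} (h : m + n = k + 1) (i : Fin m) (r : Fin k) : Fin m :=
  if _ : r.val < i.val then ⟨r, by omega⟩
  else if _ : r.val < i.val + n then i
  else ⟨r + 1 - n, by omega⟩

theorem R₀_spec {m n k : ℕ} (h : m + n = k + 1) (i : Fin m) (r : Fin k) :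
    (r.val < i.val ∧ (R₀ h i r).val = r.val) ∨
    (i.val ≤ r.val ∧ r.val < i.val + n ∧ (R₀ h i r).val = i.val) ∨
    (i.val + n ≤ r.val ∧ (R₀ h i r).val + n = r.val + 1) := by
  unfold R₀
  split_ifs with h1 h2
  · exact Or.inl ⟨h1, rfl⟩
  · exact Or.inr (Or.inl ⟨by omega, h2, rfl⟩)
  · exact Or.inr (Or.inr ⟨by omega, by simp only; omega⟩)

/-- The map `Rᵢ(m; 1, …, n, …, 1) : C_k → K[C_n]`, where `k = m + n - 1` and `n` is at
place `i`. -/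
def Rᵢ (K : Type u) [Field K] {m : ℕ} (n : ℕ) {k : ℕ} (i : Fin m) (r : Fin k) : Fin n →₀ K :=
  if h : i.val ≤ r.val ∧ r.val < i.val + n then Finsupp.single ⟨r - i, by omega⟩ 1
  else ∑ s : Fin n, Finsupp.single s 1

theorem Rᵢ_congr {m m' n k k' : ℕ} (i : Fin m) (r : Fin k) (i' : Fin m') (r' : Fin k')
    (h : (i.val ≤ r.val ∧ r.val < i.val + n ∧ i'.val ≤ r'.val ∧ r'.val < i'.val + n ∧
      r.val - i.val = r'.val - i'.val) ∨
      (¬ (i.val ≤ r.val ∧ r.val < i.val + n) ∧ ¬ (i'.val ≤ r'.val ∧ r'.val < i'.val + n))) :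
    Rᵢ K n i r = Rᵢ K n i' r' := by
  rcases h with ⟨a, b, c, d, e⟩ | ⟨a, b⟩
  · rw [Rᵢ, Rᵢ, dif_pos ⟨a, b⟩, dif_pos ⟨c, d⟩]
    congr 1
    exact Fin.ext e
  · rw [Rᵢ, Rᵢ, dif_neg a, dif_neg b]

/-- A map `K[C_n] ⊗ V^{⊗ n} → V` is a family `f_[r]`, `r ∈ C_n`, of multilinear maps
`V^n → V`. -/
abbrev DendMap (K : Type u) [Field K] (V : Type v) [AddCommGroup V] [Module K V] (n : ℕ) : Type v :=
  Fin n → MultilinearMap K (fun _ : Fin n => V) V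

/-- The multilinear map `f(x; -)` for a linear combination `x ∈ K[C_n]`. -/
def DendMap.eval {n : ℕ} (x : Fin n →₀ K) :
    DendMap K V n →ₗ[K] MultilinearMap K (fun _ : Fin n => V) V :=
  ∑ s : Fin n, x s • LinearMap.proj s

theorem DendMap.eval_apply {n : ℕ} (x : Fin n →₀ K) (f : DendMap K V n) :
    DendMap.eval x f = ∑ s : Fin n, x s • f s := by
  simp [DendMap.eval]

/-- The partial composition
`(f ∘ᵢ g)([r]; …) = f(R₀ [r]; a₁, …, g(Rᵢ [r]; aᵢ, …), …)`. -/
def dendComp {m n k : ℕ} (h : m + n = k + 1) (i : Fin m) :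
    DendMap K V m →ₗ[K] DendMap K V n →ₗ[K] DendMap K V k :=
  LinearMap.mk₂ K (fun f g r => multCompL h i (f (R₀ h i r)) (DendMap.eval (Rᵢ K n i r) g))
    (fun _ _ _ => by funext r; simp) (fun _ _ _ => by funext r; simp)
    (fun _ _ _ => by funext r; simp) (fun _ _ _ => by funext r; simp)

theorem dendComp_apply {m n k : ℕ} (h : m + n = k + 1) (i : Fin m) (f : DendMap K V m)
    (g : DendMap K V n) (r : Fin k) :
    dendComp h i f g r = multCompL h i (f (R₀ h i r)) (DendMap.eval (Rᵢ K n i r) g) := rfl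

theorem eval_Rᵢ_of_mem {m n k : ℕ} (i : Fin m) (r : Fin k)
    (hr : i.val ≤ r.val ∧ r.val < i.val + n) (g : DendMap K V n) :
    DendMap.eval (Rᵢ K n i r) g = g ⟨r - i, by omega⟩ := by
  rw [DendMap.eval_apply, Rᵢ, dif_pos hr]
  simp [Finsupp.single_apply]

theorem eval_Rᵢ_of_notMem {m n k : ℕ} (i : Fin m) (r : Fin k)
    (hr : ¬ (i.val ≤ r.val ∧ r.val < i.val + n)) (g : DendMap K V n) :
    DendMap.eval (Rᵢ K n i r) g = ∑ s, g s := by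
  rw [DendMap.eval_apply, Rᵢ, dif_neg hr]
  simp [Finsupp.single_apply, Finsupp.finsetSum_apply]

theorem sum_dendComp {m n k : ℕ} (h : m + n = k + 1) (i : Fin m) (f : DendMap K V m)
    (g : DendMap K V n) :
    ∑ r, dendComp h i f g r = multCompL h i (∑ s, f s) (∑ s, g s) := by
  rw [map_sum (multCompL h i), LinearMap.sum_apply, ← Finset.sum_fiberwise (s := Finset.univ) (g := R₀ h i)]
  refine Finset.sum_congr rfl fun s _ => ?_
  by_cases hs : s = i
  · subst hs
    rw [map_sum]
    have hmem : ∀ r ∈ Finset.univ.filter (fun r => R₀ h s r = s),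
        s.val ≤ r.val ∧ r.val < s.val + n := by
      intro r hr
      have h1 := congrArg Fin.val (Finset.mem_filter.mp hr).2
      have h2 := R₀_spec h s r
      have h3 := s.isLt
      omega
    refine Finset.sum_bij' (i := fun r hr => ⟨r.val - s.val, by have := hmem r hr; omega⟩)
      (j := fun t _ => ⟨s.val + t.val, by omega⟩) ?_ ?_ ?_ ?_ ?_
    · simp
    · intro t _
      refine Finset.mem_filter.mpr ⟨Finset.mem_univ _, Fin.ext ?_⟩
      have h2 := R₀_spec h s ⟨s.val + t.val, by omega⟩
      simp only at h2
      omega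
    · intro r hr
      have := hmem r hr
      ext; simp only; omega
    · intro t _
      ext
      simp
    · intro r hr
      rw [dendComp_apply, (Finset.mem_filter.mp hr).2, eval_Rᵢ_of_mem _ _ (hmem r hr)]
  · have hs' : s.val ≠ i.val := fun e => hs (Fin.ext e)
    have hr₀ : ∃ r : Fin k, R₀ h i r = s ∧ ¬ (i.val ≤ r.val ∧ r.val < i.val + n) := by
      by_cases h1 : s.val < i.val
      · refine ⟨⟨s, by omega⟩, Fin.ext ?_, by simp only; omega⟩
        have h2 := R₀_spec h i ⟨s, by omega⟩
        simp only at h2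
        omega
      · refine ⟨⟨s + n - 1, by omega⟩, Fin.ext ?_, by simp only; omega⟩
        have h2 := R₀_spec h i ⟨s + n - 1, by omega⟩
        simp only at h2
        omega
    obtain ⟨r₀, hr₀, hn⟩ := hr₀
    rw [Finset.sum_eq_single r₀]
    · rw [dendComp_apply, hr₀, eval_Rᵢ_of_notMem _ _ hn]
    · intro r hr hne
      refine absurd (Fin.ext ?_) hne
      have h1 := congrArg Fin.val (Finset.mem_filter.mp hr).2
      have h2 := R₀_spec h i r
      have h3 := R₀_spec h i r₀
      rw [hr₀] at h3
      omega
    · simp [hr₀]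

theorem dendComp_seq {m n p a b c : ℕ} (h₁ : m + n = a + 1) (h₂ : a + p = c + 1)
    (h₃ : n + p = b + 1) (h₄ : m + b = c + 1) (i : Fin m) (j : Fin n)
    (f : DendMap K V m) (g : DendMap K V n) (e : DendMap K V p) :
    dendComp h₂ ⟨i + j, by omega⟩ (dendComp h₁ i f g) e
      = dendComp h₄ i f (dendComp h₃ j g e) := by
  funext r
  have key : ∀ x y, multCompL h₂ ⟨i + j, by omega⟩ (multCompL h₁ i x y)
      = (multCompL (K := K) (V := V) h₄ i x) ∘ₗ (multCompL h₃ j y) := by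
    intro x y; ext1 z; exact multComp_seq h₁ h₂ h₃ h₄ i j x y z
  simp only [dendComp_apply, key, LinearMap.comp_apply]
  have s1 := R₀_spec h₂ ⟨i + j, by omega⟩ r
  have s2 := R₀_spec h₁ i (R₀ h₂ ⟨i + j, by omega⟩ r)
  have s3 := R₀_spec h₄ i r
  simp only at s1
  have e1 : R₀ h₁ i (R₀ h₂ ⟨i + j, by omega⟩ r) = R₀ h₄ i r := Fin.ext (by omega)
  rw [e1]
  congr 1
  by_cases hr : i.val ≤ r.val ∧ r.val < i.val + b
  · rw [eval_Rᵢ_of_mem i r hr, dendComp_apply]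
    have hA : i.val ≤ (R₀ h₂ ⟨i + j, by omega⟩ r).val ∧
        (R₀ h₂ ⟨i + j, by omega⟩ r).val < i.val + n := by omega
    rw [eval_Rᵢ_of_mem i _ hA]
    have s4 := R₀_spec h₃ j ⟨r.val - i.val, by omega⟩
    simp only at s4
    have e2 : (⟨(R₀ h₂ ⟨i + j, by omega⟩ r).val - i.val, by omega⟩ : Fin n)
        = R₀ h₃ j ⟨r.val - i.val, by omega⟩ := Fin.ext (by simp only; omega)
    have e3 : Rᵢ K p (⟨i + j, by omega⟩ : Fin a) r
        = Rᵢ K p j (⟨r.val - i.val, by omega⟩ : Fin b) :=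
      Rᵢ_congr _ _ _ _ (by simp only; omega)
    rw [e2, e3]
  · rw [eval_Rᵢ_of_notMem i r hr, sum_dendComp]
    have hA : ¬ (i.val ≤ (R₀ h₂ ⟨i + j, by omega⟩ r).val ∧
        (R₀ h₂ ⟨i + j, by omega⟩ r).val < i.val + n) := by omega
    rw [eval_Rᵢ_of_notMem i _ hA, eval_Rᵢ_of_notMem _ _ (by simp only; omega)]

theorem dendComp_par {m n p a b c : ℕ} (h₁ : m + n = a + 1) (h₂ : a + p = c + 1)
    (h₃ : m + p = b + 1) (h₄ : b + n = c + 1) (i k : Fin m) (hik : i.val < k.val)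
    (f : DendMap K V m) (g : DendMap K V n) (e : DendMap K V p) :
    dendComp h₂ ⟨k + n - 1, by omega⟩ (dendComp h₁ i f g) e
      = dendComp h₄ ⟨i, by omega⟩ (dendComp h₃ k f e) g := by
  funext r
  have key : ∀ x y z, multCompL h₂ ⟨k + n - 1, by omega⟩ (multCompL h₁ i x y) z
      = multCompL (K := K) (V := V) h₄ ⟨i, by omega⟩ (multCompL h₃ k x z) y :=
    fun x y z => multComp_par h₁ h₂ h₃ h₄ i k hik x y z
  simp only [dendComp_apply, key]
  have s1 := R₀_spec h₂ ⟨k + n - 1, by omega⟩ r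
  have s2 := R₀_spec h₁ i (R₀ h₂ ⟨k + n - 1, by omega⟩ r)
  have s3 := R₀_spec h₄ ⟨i, by omega⟩ r
  have s4 := R₀_spec h₃ k (R₀ h₄ ⟨i, by omega⟩ r)
  simp only at s1 s3
  have e1 : R₀ h₁ i (R₀ h₂ ⟨k + n - 1, by omega⟩ r) = R₀ h₃ k (R₀ h₄ ⟨i, by omega⟩ r) :=
    Fin.ext (by omega)
  have e2 : Rᵢ K n i (R₀ h₂ ⟨k + n - 1, by omega⟩ r) = Rᵢ K n (⟨i, by omega⟩ : Fin b) r :=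
    Rᵢ_congr _ _ _ _ (by simp only; omega)
  have e3 : Rᵢ K p (⟨k + n - 1, by omega⟩ : Fin a) r = Rᵢ K p k (R₀ h₄ ⟨i, by omega⟩ r) :=
    Rᵢ_congr _ _ _ _ (by simp only; omega)
  rw [e1, e2, e3]

end Multilinear

section Equivariant

variable {K : Type u} [Field K] {G : Type w} [Group G] {V : Type v} [AddCommGroup V] [Module K V]

/-- `Hom_{Rep(G)}(V^{⊗ n}, V)`: the equivariant multilinear maps. For `n = 0` this is the space of
invariants of `V`. -/
def EndHom (ρ : Representation K G V) (n : ℕ) :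
    Submodule K (MultilinearMap K (fun _ : Fin n => V) V) where
  carrier := {f | ∀ (x : G) (v : Fin n → V), f (fun l => ρ x (v l)) = ρ x (f v)}
  add_mem' hf hg x v := by simp [hf x v, hg x v]
  zero_mem' x v := by simp
  smul_mem' c f hf x v := by simp [hf x v]

/-- `C^n_G(V, V) = Hom_{Rep(G)}(K[C_n] ⊗ V^{⊗ n}, V)`, with `G` acting trivially on `K[C_n]`:
the families `f_[r]`, `r ∈ C_n`, of equivariant multilinear maps. It is zero for `n = 0`. -/
def DendHom (ρ : Representation K G V) (n : ℕ) : Submodule K (DendMap K V n) where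
  carrier := {f | ∀ (r : Fin n) (x : G) (v : Fin n → V),
    f r (fun l => ρ x (v l)) = ρ x (f r v)}
  add_mem' hf hg r x v := by simp [hf r x v, hg r x v]
  zero_mem' r x v := by simp
  smul_mem' c f hf r x v := by simp [hf r x v]

variable (ρ : Representation K G V)

theorem multCompL_mem {m n k : ℕ} (h : m + n = k + 1) (i : Fin m)
    {f : MultilinearMap K (fun _ : Fin m => V) V} (hf : f ∈ EndHom ρ m)
    {g : MultilinearMap K (fun _ : Fin n => V) V} (hg : g ∈ EndHom ρ n) :
    multCompL h i f g ∈ EndHom ρ k := by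
  intro x v
  rw [multCompL_apply, multComp_apply, multComp_apply, ← hf x]
  congr 1; funext j
  simp only [insertArgs]
  split_ifs
  · rfl
  · exact hg x _
  · rfl

theorem eval_mem {n : ℕ} (x : Fin n →₀ K) {f : DendMap K V n} (hf : f ∈ DendHom ρ n) :
    DendMap.eval x f ∈ EndHom ρ n := by
  rw [DendMap.eval_apply]
  exact Submodule.sum_mem _ fun s _ => Submodule.smul_mem _ _ (hf s)

/-- The operad `{Hom_{Rep(G)}(V^{⊗ n}, V)}` of equivariant multilinear maps. -/
def endOperad : NSOperad.{u, v} K where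
  carrier n := EndHom ρ n
  comp h i := LinearMap.mk₂ K
    (fun f g => ⟨multCompL h i f.val g.val, multCompL_mem ρ h i f.property g.property⟩)
    (fun _ _ _ => by ext1; simp) (fun _ _ _ => by ext1; simp)
    (fun _ _ _ => by ext1; simp) (fun _ _ _ => by ext1; simp)
  one := ⟨multOne K V, fun x v => by simp [multOne]⟩
  one_comp h f := Subtype.ext (multComp_one_left h f.val)
  comp_one i f := Subtype.ext (multComp_one_right i f.val)
  comp_seq h₁ h₂ h₃ h₄ i j f g e := Subtype.ext (multComp_seq h₁ h₂ h₃ h₄ i j f.val g.val e.val)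
  comp_par h₁ h₂ h₃ h₄ i k hik f g e :=
    Subtype.ext (multComp_par h₁ h₂ h₃ h₄ i k hik f.val g.val e.val)

/-- The operad `{C^n_G(V, V)}` of equivariant dendriform cochains. -/
def dendOperad : NSOperad.{u, v} K where
  carrier n := DendHom ρ n
  comp h i := LinearMap.mk₂ K
    (fun f g => ⟨dendComp h i f.val g.val, fun r =>
      multCompL_mem ρ h i (f.property (R₀ h i r)) (eval_mem ρ (Rᵢ K _ i r) g.property)⟩)
    (fun _ _ _ => by ext1; simp) (fun _ _ _ => by ext1; simp)
    (fun _ _ _ => by ext1; simp) (fun _ _ _ => by ext1; simp)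
  one := ⟨fun _ => multOne K V, fun r x v => by simp [multOne]⟩
  one_comp {n} h f := by
    refine Subtype.ext (funext fun r => ?_)
    have hr : (0 : Fin 1).val ≤ r.val ∧ r.val < (0 : Fin 1).val + n := ⟨by simp, by simp⟩
    refine (congrArg (multCompL h 0 (multOne K V)) (eval_Rᵢ_of_mem 0 r hr f.val)).trans ?_
    exact multComp_one_left h (f.val r)
  comp_one i f := by
    refine Subtype.ext (funext fun r => ?_)
    have h0 : R₀ rfl i r = r := Fin.ext (by have := R₀_spec rfl i r; omega)
    have h1 : DendMap.eval (Rᵢ K 1 i r) (fun _ => multOne K V) = multOne K V := by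
      by_cases hr : i.val ≤ r.val ∧ r.val < i.val + 1
      · rw [eval_Rᵢ_of_mem i r hr]
      · rw [eval_Rᵢ_of_notMem i r hr]; simp
    have h2 : dendComp rfl i f.val (fun _ => multOne K V) r = f.val r := by
      rw [dendComp_apply, h1, h0]
      exact multComp_one_right i (f.val r)
    exact h2
  comp_seq h₁ h₂ h₃ h₄ i j f g e := Subtype.ext (dendComp_seq h₁ h₂ h₃ h₄ i j f.val g.val e.val)
  comp_par h₁ h₂ h₃ h₄ i k hik f g e :=
    Subtype.ext (dendComp_par h₁ h₂ h₃ h₄ i k hik f.val g.val e.val)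

/-- The map `S_n : f ↦ f_[1] + ⋯ + f_[n]`. -/
def sumMap (n : ℕ) : (dendOperad ρ).carrier n →ₗ[K] (endOperad ρ).carrier n where
  toFun f := ⟨∑ r : Fin n, f.val r, Submodule.sum_mem _ fun r _ => f.property r⟩
  map_add' f g :=
    Subtype.ext (Finset.sum_add_distrib (f := f.val) (g := g.val) (s := Finset.univ))
  map_smul' c f := Subtype.ext (Finset.smul_sum (r := c) (f := f.val) (s := Finset.univ)).symm

/-- An associative algebra in `Rep(G)`. -/
structure EquivariantAssociative where
  mul : V →ₗ[K] V →ₗ[K] V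
  map_mul : ∀ (x : G) (a b : V), mul (ρ x a) (ρ x b) = ρ x (mul a b)
  assoc : ∀ a b c : V, mul (mul a b) c = mul a (mul b c)

/-- A dendriform algebra in `Rep(G)`; `prec a b` is `a ≺ b` and `succ a b` is `a ≻ b`. -/
structure EquivariantDendriform where
  prec : V →ₗ[K] V →ₗ[K] V
  succ : V →ₗ[K] V →ₗ[K] V
  map_prec : ∀ (x : G) (a b : V), prec (ρ x a) (ρ x b) = ρ x (prec a b)
  map_succ : ∀ (x : G) (a b : V), succ (ρ x a) (ρ x b) = ρ x (succ a b)
  prec_prec : ∀ a b c : V, prec (prec a b) c = prec a (prec b c + succ b c)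
  succ_prec : ∀ a b c : V, prec (succ a b) c = succ a (prec b c)
  succ_succ : ∀ a b c : V, succ (prec a b + succ a b) c = succ a (succ b c)

/-- A bilinear map as a multilinear map in two variables. -/
def bilinToMultilinear (B : V →ₗ[K] V →ₗ[K] V) : MultilinearMap K (fun _ : Fin 2 => V) V where
  toFun v := B (v 0) (v 1)
  map_update_add' {inst} v i x y := by
    have hd : inst = instDecidableEqFin 2 := Subsingleton.elim _ _
    rw [hd]
    fin_cases i <;> simp
  map_update_smul' {inst} v i c x := by
    have hd : inst = instDecidableEqFin 2 := Subsingleton.elim _ _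
    rw [hd]
    fin_cases i <;> simp

variable {ρ}

namespace EquivariantAssociative

variable (A : EquivariantAssociative ρ)

/-- The product of an equivariant associative algebra, as a multiplication on the operad of
equivariant multilinear maps. -/
def multiplication : (endOperad ρ).Multiplication where
  val := ⟨bilinToMultilinear A.mul, fun x v => A.map_mul x (v 0) (v 1)⟩
  assoc := by
    refine Subtype.ext ?_
    ext v
    exact A.assoc (v 0) (v 1) (v 2)

/-- The Hochschild cohomology `H^n_Hoch(V, V)` in `Rep(G)`. -/
abbrev hochschildCohomology (n : ℕ) : Type v := A.multiplication.cohomology n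

end EquivariantAssociative

namespace EquivariantDendriform

variable (D : EquivariantDendriform ρ)

/-- The associative algebra with product `≺ + ≻`. -/
def toAssociative : EquivariantAssociative ρ where
  mul := D.prec + D.succ
  map_mul x a b := by simp [D.map_prec, D.map_succ]
  assoc a b c := by
    have h1 := D.prec_prec a b c
    have h2 := D.succ_prec a b c
    have h3 := D.succ_succ a b c
    simp only [LinearMap.add_apply, map_add] at *
    rw [h1, h2, ← h3]
    abel

/-- The element `π` with `π_[1] = ≺` and `π_[2] = ≻`, as a multiplication on the operad of
equivariant dendriform cochains. -/
def multiplication : (dendOperad ρ).Multiplication where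
  val := ⟨![bilinToMultilinear D.prec, bilinToMultilinear D.succ], fun r x v => by
    fin_cases r
    · exact D.map_prec x (v 0) (v 1)
    · exact D.map_succ x (v 0) (v 1)⟩
  assoc := by
    refine Subtype.ext (funext fun r => ?_)
    set p : DendMap K V 2 := ![bilinToMultilinear D.prec, bilinToMultilinear D.succ] with hp
    change dendComp (rfl : 2 + 2 = 3 + 1) 0 p p r = dendComp (rfl : 2 + 2 = 3 + 1) 1 p p r
    rw [dendComp_apply, dendComp_apply]
    have hs : ∑ s, p s = bilinToMultilinear D.prec + bilinToMultilinear D.succ := by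
      simp [hp, Fin.sum_univ_two]
    fin_cases r
    · rw [eval_Rᵢ_of_mem (0 : Fin 2) _ (by simp), eval_Rᵢ_of_notMem (1 : Fin 2) _ (by simp), hs]
      ext v
      exact D.prec_prec (v 0) (v 1) (v 2)
    · rw [eval_Rᵢ_of_mem (0 : Fin 2) _ (by simp), eval_Rᵢ_of_mem (1 : Fin 2) _ (by simp)]
      ext v
      exact D.succ_prec (v 0) (v 1) (v 2)
    · rw [eval_Rᵢ_of_notMem (0 : Fin 2) _ (by simp), eval_Rᵢ_of_mem (1 : Fin 2) _ (by simp), hs]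
      ext v
      exact D.succ_succ (v 0) (v 1) (v 2)

/-- The equivariant cohomology `H^n_G(V, V)`. -/
abbrev equivariantCohomology (n : ℕ) : Type v := D.multiplication.cohomology n

end EquivariantDendriform

end Equivariant

end EquivDend

end

noncomputable section

namespace EquivDend

open scoped DirectSum

universe u v w

/-! The operations δ, ∪ and [ , ] are built from partial compositions and the multiplication alone.
A morphism of operads that carries one multiplication to the other therefore commutes with all
three. The theorem thus splits into a fact about `sumMap` and Gerstenhaber's theorem for an
arbitrary operad with multiplication.

The fact about `sumMap` is `sum_dendComp`: the sum of (f ∘ᵢ g)_[r] over r is grouped by the fibres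
of R₀. On the fibre over i, Rᵢ runs once through C_n; any other fibre is a single point, where Rᵢ
equals [1] + ⋯ + [n]. Either way g contributes its full sum.

For Gerstenhaber's theorem, associativity of π says that π ∘ π = 0 for the circle product, and δ is
[π, -] up to sign (`incl_delta`). By `circ_circ` the associator of ∘ consists of the braces x{y, z}
and x{z, y}, so it is symmetric up to sign; this yields the Jacobi identity and δ² = 0. Moreover
π{x, y} is x ∪ y up to sign, and a triple brace does not fit into the two inputs of π. Hence
`circ_brace` and `brace_circ`, applied with π outermost, show that - ∘ z and δ are graded
derivations of ∪ on cochains. For cocycles, the failure of ∪ to commute is, up to sign, the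
coboundary of x ∘ y (`cup_comm`), and the failure of z ∘ - to be a derivation of ∪ is that of z{x,
y} (`circ_cup_right`).

To avoid types depending on arities, these identities are proved in the direct sum of all arities,
with the composition at i extended by zero to elements without an input i. Arities then enter only
as numbers in signs and summation ranges. -/

theorem neg_one_pow_congr {K : Type u} [Field K] {a b : ℕ} (h : Even a ↔ Even b) :
    (-1 : K) ^ a = (-1) ^ b := by
  rcases Nat.even_or_odd a with ha | ha
  · rw [ha.neg_one_pow, (h.mp ha).neg_one_pow]
  · rw [ha.neg_one_pow,
      (Nat.not_even_iff_odd.mp fun hb => Nat.not_even_iff_odd.mpr ha (h.mpr hb)).neg_one_pow]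

/-- Normal form for the parity case splits below: once the parities are fixed, every sign is 1 or -1
and only linear algebra remains. -/
theorem neg_one_pow_ite {K : Type u} [Field K] (n : ℕ) :
    (-1 : K) ^ n = if Even n then 1 else -1 := by
  split_ifs with h
  · exact h.neg_one_pow
  · exact (Nat.not_even_iff_odd.mp h).neg_one_pow

/-- Pairs of slots i < k, indexed once by the right slot and once by the left slot and the gap.
Braces are summed in the first way, iterated circle products in the second. -/
theorem sum_range_triangle {E : Type*} [AddCommMonoid E] (M : ℕ) (F : ℕ → ℕ → E) :
    ∑ k ∈ Finset.range M, ∑ i ∈ Finset.range k, F i k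
      = ∑ i ∈ Finset.range M, ∑ l ∈ Finset.range (M - 1 - i), F i (i + 1 + l) := by
  have h : ∀ i ∈ Finset.range M, ∑ l ∈ Finset.range (M - 1 - i), F i (i + 1 + l)
      = ∑ k ∈ Finset.Ico (i + 1) M, F i k := by
    intro i _
    rw [Finset.sum_Ico_eq_sum_range]
    congr 2
    omega
  rw [Finset.sum_congr rfl h]
  refine Finset.sum_comm' fun x y => ?_
  simp only [Finset.mem_range, Finset.mem_Ico]
  omega

/-! ### Circle products and braces in ungraded form -/

/-- A graded vector space with partial compositions `comp i` satisfying the axioms of a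
non-symmetric operad, in ungraded form: `comp i x y` is zero if `i` is not an input of `x`. -/
structure TotalOperad (K : Type u) (T : Type v) [Field K] [AddCommGroup T] [Module K T] where
  comp : ℕ → T →ₗ[K] T →ₗ[K] T
  homog : ℕ → Submodule K T
  comp_eq_zero : ∀ {m i : ℕ} {x : T}, x ∈ homog m → m ≤ i → ∀ y, comp i x y = 0
  comp_mem : ∀ {m n k : ℕ}, m + n = k + 1 → ∀ (i : ℕ) {x y : T}, x ∈ homog m → y ∈ homog n →
    comp i x y ∈ homog k
  comp_seq : ∀ {n i j : ℕ}, j < n → ∀ (x : T) {y : T}, y ∈ homog n → ∀ z : T,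
    comp (i + j) (comp i x y) z = comp i x (comp j y z)
  comp_par : ∀ {n i k q : ℕ}, i < k → q + 1 = k + n → ∀ (x : T) {y : T}, y ∈ homog n → ∀ z : T,
    comp q (comp i x y) z = comp i (comp k x z) y

namespace TotalOperad

variable {K : Type u} {T : Type v} [Field K] [AddCommGroup T] [Module K T] (P : TotalOperad K T)

/-- The sum `∑ (-1)^(i d) x ∘ᵢ y` over the first `m` inputs. -/
def circ (m d : ℕ) : T →ₗ[K] T →ₗ[K] T :=
  ∑ i ∈ Finset.range m, (-1 : K) ^ (i * d) • P.comp i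

/-- The brace `x{y, z}`, the signed sum of all ways to insert `y` and `z` in this order at two of
the first `m` inputs of `x`; the arguments are written in the order `x`, `z`, `y`. -/
def brace (m d e : ℕ) : T →ₗ[K] T →ₗ[K] T →ₗ[K] T :=
  ∑ k ∈ Finset.range m, (-1 : K) ^ (k * e) • (P.comp k).compr₂ (P.circ k d)

/-- The brace `x{y, z, w}`; the arguments are written in the order `x`, `w`, `z`, `y`. -/
def brace₃ (m d e t : ℕ) : T →ₗ[K] T →ₗ[K] T →ₗ[K] T →ₗ[K] T :=
  ∑ k ∈ Finset.range m, (-1 : K) ^ (k * t) • (P.comp k).compr₂ (P.brace k d e)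

variable {P}

theorem circ_apply (m d : ℕ) (x y : T) :
    P.circ m d x y = ∑ i ∈ Finset.range m, (-1 : K) ^ (i * d) • P.comp i x y := by
  simp [circ, LinearMap.sum_apply]

theorem brace_apply (m d e : ℕ) (x z y : T) :
    P.brace m d e x z y
      = ∑ k ∈ Finset.range m, (-1 : K) ^ (k * e) • P.circ k d (P.comp k x z) y := by
  simp [brace, LinearMap.sum_apply]

theorem brace₃_apply (m d e t : ℕ) (x w z y : T) :
    P.brace₃ m d e t x w z y
      = ∑ k ∈ Finset.range m, (-1 : K) ^ (k * t) • P.brace k d e (P.comp k x w) z y := by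
  simp [brace₃, LinearMap.sum_apply]

theorem circ_congr {m d e : ℕ} (h : Even d ↔ Even e) : P.circ m d = P.circ m e := by
  refine Finset.sum_congr rfl fun i _ => ?_
  rw [neg_one_pow_congr]
  simp only [Nat.even_mul, h]

theorem circ_mem {m n k : ℕ} (h : m + n = k + 1) (M d : ℕ) {x y : T}
    (hx : x ∈ P.homog m) (hy : y ∈ P.homog n) : P.circ M d x y ∈ P.homog k := by
  rw [circ_apply]
  exact Submodule.sum_mem _ fun i _ => Submodule.smul_mem _ _ (P.comp_mem h i hx hy)

theorem brace_mem {m n p k : ℕ} (h : p + m + n = k + 2) (M d e : ℕ) {x y z : T}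
    (hx : x ∈ P.homog m) (hy : y ∈ P.homog n) (hz : z ∈ P.homog p) :
    P.brace M d e z y x ∈ P.homog k := by
  rw [brace_apply]
  refine Submodule.sum_mem _ fun i _ => Submodule.smul_mem _ _ ?_
  -- For p = n = 0 the arity p + n - 1 would be truncated, but then `z` has no inputs at all.
  by_cases hpn : p + n = 0
  · rw [P.comp_eq_zero hz (by omega), map_zero, LinearMap.zero_apply]
    exact zero_mem _
  · exact circ_mem (m := p + n - 1) (by omega) _ _ (P.comp_mem (by omega) i hz hy) hx

/-- Parallel insertion: the slot of `z` lies to the right of every slot that the circle product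
uses, so the insertions commute and the slot merely shifts by n - 1. -/
theorem comp_circ {n M q q' : ℕ} (hM : M ≤ q) (hq : q' + 1 = q + n) (d : ℕ) (x : T)
    {y : T} (hy : y ∈ P.homog n) (z : T) :
    P.comp q' (P.circ M d x y) z = P.circ M d (P.comp q x z) y := by
  simp only [circ_apply, map_sum, map_smul, LinearMap.sum_apply, LinearMap.smul_apply]
  refine Finset.sum_congr rfl fun i hi => ?_
  rw [P.comp_par (by rw [Finset.mem_range] at hi; omega) hq x hy]

/-! ### Pre-Lie and higher brace identities -/

/-- The graded pre-Lie identity, with the associator expressed by braces. -/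
theorem circ_circ {n M N : ℕ} (hN : M ≠ 0 → M + n = N + 1) (e : ℕ) (x : T) {y : T}
    (hy : y ∈ P.homog n) (z : T) :
    P.circ N e (P.circ M (n + 1) x y) z
      = P.circ M (n + 1 + e) x (P.circ n e y z)
        + (-1 : K) ^ ((n + 1) * e) • P.brace M (n + 1) e x z y
        + P.brace M e (n + 1) x y z := by
  have h₁ : P.circ N e (P.circ M (n + 1) x y) z = ∑ i ∈ Finset.range M,
      (-1 : K) ^ (i * (n + 1)) • P.circ N e (P.comp i x y) z := by
    rw [circ_apply M]
    simp only [map_sum, map_smul, LinearMap.sum_apply, LinearMap.smul_apply]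
  have h₂ : (-1 : K) ^ ((n + 1) * e) • P.brace M (n + 1) e x z y
      = ∑ i ∈ Finset.range M, ∑ l ∈ Finset.range (M - 1 - i),
        (-1 : K) ^ ((n + 1) * e + ((i + 1 + l) * e + i * (n + 1))) •
          P.comp i (P.comp (i + 1 + l) x z) y := by
    simp only [brace_apply, circ_apply, Finset.smul_sum, smul_smul, ← pow_add]
    exact sum_range_triangle M fun i k => (-1 : K) ^ ((n + 1) * e + (k * e + i * (n + 1))) •
          P.comp i (P.comp k x z) y
  rw [h₁, h₂, brace_apply, circ_apply M, ← Finset.sum_add_distrib, ← Finset.sum_add_distrib]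
  refine Finset.sum_congr rfl fun i hi => ?_
  rw [Finset.mem_range] at hi
  -- The inputs of x ∘ᵢ y fall into three blocks: those of `x` left of slot i, those of `y`, and
  -- those of `x` right of slot i. Inserting `z` there gives x{z, y}, x ∘ (y ∘ z) and x{y, z}
  -- respectively.
  obtain rfl : N = i + n + (M - 1 - i) := by have := hN (by omega); omega
  rw [circ_apply (i + n + (M - 1 - i)), Finset.sum_range_add, Finset.sum_range_add, smul_add,
    smul_add, circ_apply i]
  have h₃ : (-1 : K) ^ (i * (n + 1)) • ∑ j ∈ Finset.range n, (-1 : K) ^ ((i + j) * e) •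
      P.comp (i + j) (P.comp i x y) z
      = (-1 : K) ^ (i * (n + 1 + e)) • P.comp i x (P.circ n e y z) := by
    simp only [circ_apply, map_sum, map_smul, Finset.smul_sum, smul_smul, ← pow_add]
    refine Finset.sum_congr rfl fun j hj => ?_
    rw [P.comp_seq (Finset.mem_range.mp hj) x hy]
    refine congrArg (· • _) (neg_one_pow_congr ?_)
    simp only [Nat.even_add, Nat.even_mul, Nat.not_even_one]
    grind
  have h₄ : (-1 : K) ^ (i * (n + 1)) • ∑ l ∈ Finset.range (M - 1 - i),
      (-1 : K) ^ ((i + n + l) * e) • P.comp (i + n + l) (P.comp i x y) z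
      = ∑ l ∈ Finset.range (M - 1 - i),
        (-1 : K) ^ ((n + 1) * e + ((i + 1 + l) * e + i * (n + 1))) •
          P.comp i (P.comp (i + 1 + l) x z) y := by
    simp only [Finset.smul_sum, smul_smul, ← pow_add]
    refine Finset.sum_congr rfl fun l _ => ?_
    rw [P.comp_par (k := i + 1 + l) (by omega) (by omega) x hy]
    refine congrArg (· • _) (neg_one_pow_congr ?_)
    simp only [Nat.even_add, Nat.even_mul, Nat.not_even_one]
    grind
  rw [h₃, h₄]
  abel

theorem circ_zero (d : ℕ) : P.circ 0 d = 0 := by simp [circ]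

theorem brace_zero (d e : ℕ) : P.brace 0 d e = 0 := by simp [brace]

/-- The first a + j inputs of x ∘ₐ y are a inputs of `x` followed by the first j inputs of `y`; the
bound j ≤ p keeps the latter inside `y`. -/
theorem circ_add_comp {a j p : ℕ} (hj : j ≤ p) (d : ℕ) (x : T) {y : T} (hy : y ∈ P.homog p)
    (z : T) : P.circ (a + j) d (P.comp a x y) z
      = P.circ a d (P.comp a x y) z + (-1 : K) ^ (a * d) • P.comp a x (P.circ j d y z) := by
  rw [circ_apply, Finset.sum_range_add, circ_apply a, circ_apply j]
  simp only [map_sum, map_smul, Finset.smul_sum, smul_smul, ← pow_add]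
  congr 1
  refine Finset.sum_congr rfl fun i hi => ?_
  rw [P.comp_seq (by rw [Finset.mem_range] at hi; omega) x hy, add_mul]

/-- In x{y, z} ∘ t, the element `t` can go into `y`, into `z`, or into an input of `x` left of,
between or right of them. This gives the two double and three triple braces. -/
theorem circ_brace {m n M N : ℕ} (hN : 2 ≤ M → M + m + n = N + 2) (e : ℕ) (x : T) {y z : T}
    (hy : y ∈ P.homog m) (hz : z ∈ P.homog n) (t : T) :
    P.circ N e (P.brace M (m + 1) (n + 1) x z y) t
      = P.brace M (m + 1 + e) (n + 1) x z (P.circ m e y t)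
        + (-1 : K) ^ ((m + 1) * e) • P.brace₃ M (m + 1) e (n + 1) x z t y
        + P.brace₃ M e (m + 1) (n + 1) x z y t
        + (-1 : K) ^ ((m + 1) * e) • P.brace M (m + 1) (n + 1 + e) x (P.circ n e z t) y
        + (-1 : K) ^ ((m + 1 + (n + 1)) * e) • P.brace₃ M (m + 1) (n + 1) e x t z y := by
  have h₁ : (-1 : K) ^ ((m + 1 + (n + 1)) * e) • P.brace₃ M (m + 1) (n + 1) e x t z y
      = ∑ k ∈ Finset.range M, ∑ l ∈ Finset.range (M - 1 - k),
        (-1 : K) ^ ((m + 1 + (n + 1)) * e + ((k + 1 + l) * e + k * (n + 1))) •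
          P.circ k (m + 1) (P.comp k (P.comp (k + 1 + l) x t) z) y := by
    simp only [brace₃_apply, brace_apply, Finset.smul_sum, smul_smul, ← pow_add]
    exact sum_range_triangle M fun k q =>
      (-1 : K) ^ ((m + 1 + (n + 1)) * e + (q * e + k * (n + 1))) •
          P.circ k (m + 1) (P.comp k (P.comp q x t) z) y
  rw [h₁, brace_apply, brace_apply, brace_apply, brace₃_apply, brace₃_apply, Finset.smul_sum,
    Finset.smul_sum, map_sum, LinearMap.sum_apply, ← Finset.sum_add_distrib,
    ← Finset.sum_add_distrib, ← Finset.sum_add_distrib, ← Finset.sum_add_distrib]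
  refine Finset.sum_congr rfl fun k hk => ?_
  rw [Finset.mem_range] at hk
  rcases Nat.eq_zero_or_pos k with rfl | hk0
  · simp [circ_zero, brace_zero]
  -- With `z` at slot k, the blocks are the inputs left of `z` (`y` has replaced one of k inputs by
  -- m), those of `z`, and those right of `z`. On the first block `circ_circ` applies to x ∘ₖ z
  -- restricted to its first k inputs.
  obtain rfl : N = (k - 1 + m) + n + (M - 1 - k) := by have := hN (by omega); omega
  rw [map_smul, LinearMap.smul_apply, circ_apply (_ + _ + _), Finset.sum_range_add,
    Finset.sum_range_add, ← circ_apply, circ_circ (fun _ => by omega) e _ hy]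
  have h₂ : ∑ j ∈ Finset.range n, (-1 : K) ^ ((k - 1 + m + j) * e) •
      P.comp (k - 1 + m + j) (P.circ k (m + 1) (P.comp k x z) y) t
      = (-1 : K) ^ ((m + 1 + k) * e) • P.circ k (m + 1) (P.comp k x (P.circ n e z t)) y := by
    simp only [circ_apply n, map_sum, map_smul, Finset.smul_sum, smul_smul, ← pow_add,
      LinearMap.sum_apply, LinearMap.smul_apply]
    refine Finset.sum_congr rfl fun j hj => ?_
    rw [comp_circ (q := k + j) (by omega) (by omega) _ _ hy,
      P.comp_seq (Finset.mem_range.mp hj) x hz]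
    refine congrArg (· • _) (neg_one_pow_congr ?_)
    obtain ⟨k, rfl⟩ := Nat.exists_eq_add_of_le' hk0
    simp only [Nat.add_sub_cancel, Nat.even_add, Nat.even_mul, Nat.not_even_one]
    grind
  have h₃ : ∑ l ∈ Finset.range (M - 1 - k), (-1 : K) ^ ((k - 1 + m + n + l) * e) •
      P.comp (k - 1 + m + n + l) (P.circ k (m + 1) (P.comp k x z) y) t
      = (-1 : K) ^ (k * (n + 1)) • ∑ l ∈ Finset.range (M - 1 - k),
        (-1 : K) ^ ((m + 1 + (n + 1)) * e + ((k + 1 + l) * e + k * (n + 1))) •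
          P.circ k (m + 1) (P.comp k (P.comp (k + 1 + l) x t) z) y := by
    simp only [Finset.smul_sum, smul_smul, ← pow_add]
    refine Finset.sum_congr rfl fun l _ => ?_
    rw [comp_circ (q := k + n + l) (by omega) (by omega) _ _ hy,
      P.comp_par (k := k + 1 + l) (by omega) (by omega) x hz]
    refine congrArg (· • _) (neg_one_pow_congr ?_)
    obtain ⟨k, rfl⟩ := Nat.exists_eq_add_of_le' hk0
    simp only [Nat.add_sub_cancel, Nat.even_add, Nat.even_mul, Nat.not_even_one]
    grind
  rw [h₂, h₃]
  simp only [smul_add, smul_smul, ← pow_add, ← two_mul]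
  rw [(even_two_mul _).neg_one_pow, one_smul]
  rw [show k * (n + 1) + (m + 1 + k) * e = (m + 1) * e + k * (n + 1 + e) by ring,
    add_comm (k * (n + 1)) ((m + 1) * e)]

/-- In (x ∘ y){t, z}, the element `z` goes left of `y`, into `y` or right of `y`, and `t` then goes
anywhere to the left of `z`. -/
theorem brace_circ {m n M N : ℕ} (hN : M ≠ 0 → M + m = N + 1) (d e : ℕ) (x : T) {y z : T}
    (hy : y ∈ P.homog m) (hz : z ∈ P.homog n) (t : T) :
    P.brace N d e (P.circ M (m + 1) x y) z t
      = P.brace₃ M d e (m + 1) x y z t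
        + P.brace M d (e + (m + 1)) x (P.circ m e y z) t
        + P.circ M (m + 1 + d + e) x (P.brace m d e y z t)
        + (-1 : K) ^ ((m + 1) * e) • (P.brace M (m + 1 + d) e x z (P.circ m d y t)
          + (-1 : K) ^ ((m + 1) * d) • P.brace₃ M (m + 1) d e x z t y
          + P.brace₃ M d (m + 1) e x z y t) := by
  have h₁ : P.brace N d e (P.circ M (m + 1) x y) z t = ∑ a ∈ Finset.range M,
      (-1 : K) ^ (a * (m + 1)) • P.brace N d e (P.comp a x y) z t := by
    rw [circ_apply M]
    simp only [map_sum, map_smul, LinearMap.sum_apply, LinearMap.smul_apply]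
  -- These three terms collect the case of `z` right of `y`. For `z` at a fixed slot k, `circ_circ`
  -- on the k inputs to its left reassembles them into one iterated circle product.
  have h₂ : P.brace M (m + 1 + d) e x z (P.circ m d y t)
      + (-1 : K) ^ ((m + 1) * d) • P.brace₃ M (m + 1) d e x z t y
      + P.brace₃ M d (m + 1) e x z y t
      = ∑ a ∈ Finset.range M, ∑ l ∈ Finset.range (M - 1 - a),
        (-1 : K) ^ ((a + 1 + l) * e + a * (m + 1)) •
          P.circ (a + 1 + l - 1 + m) d (P.comp a (P.comp (a + 1 + l) x z) y) t := by
    rw [brace_apply, brace₃_apply, brace₃_apply, Finset.smul_sum, ← Finset.sum_add_distrib,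
      ← Finset.sum_add_distrib, ← sum_range_triangle M fun a k =>
        (-1 : K) ^ (k * e + a * (m + 1)) •
          P.circ (k - 1 + m) d (P.comp a (P.comp k x z) y) t]
    refine Finset.sum_congr rfl fun k _ => ?_
    rw [smul_comm, ← smul_add, ← smul_add, ← circ_circ (N := k - 1 + m) (fun _ => by omega) d _ hy,
      circ_apply k]
    simp only [map_sum, map_smul, LinearMap.sum_apply, LinearMap.smul_apply, Finset.smul_sum,
      smul_smul, ← pow_add]
  rw [h₁, h₂, brace_apply M, brace₃_apply, circ_apply M, Finset.smul_sum, ← Finset.sum_add_distrib,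
    ← Finset.sum_add_distrib, ← Finset.sum_add_distrib]
  refine Finset.sum_congr rfl fun a ha => ?_
  rw [Finset.mem_range] at ha
  obtain rfl : N = a + m + (M - 1 - a) := by have := hN (by omega); omega
  rw [brace_apply (a + m + _), Finset.sum_range_add, Finset.sum_range_add, ← brace_apply]
  -- With `z` in input j of `y`, the slots for `t` are the a inputs of `x` to the left and the first
  -- j inputs of `y`.
  have h₃ : ∑ j ∈ Finset.range m, (-1 : K) ^ ((a + j) * e) •
      P.circ (a + j) d (P.comp (a + j) (P.comp a x y) z) t
      = (-1 : K) ^ (a * e) • P.circ a d (P.comp a x (P.circ m e y z)) t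
        + (-1 : K) ^ (a * (d + e)) • P.comp a x (P.brace m d e y z t) := by
    simp only [circ_apply m, brace_apply m, map_sum, map_smul, LinearMap.sum_apply,
      LinearMap.smul_apply, Finset.smul_sum, smul_smul, ← pow_add, ← Finset.sum_add_distrib]
    refine Finset.sum_congr rfl fun j hj => ?_
    rw [Finset.mem_range] at hj
    rw [P.comp_seq hj x hy, circ_add_comp (p := m + n - 1) (by omega) d x
      (P.comp_mem (by omega) j hy hz), smul_add, smul_smul, ← pow_add]
    congr 3 <;> ring
  have h₄ : ∑ l ∈ Finset.range (M - 1 - a), (-1 : K) ^ ((a + m + l) * e) •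
      P.circ (a + m + l) d (P.comp (a + m + l) (P.comp a x y) z) t
      = (-1 : K) ^ (a * (m + 1)) • (-1 : K) ^ ((m + 1) * e) • ∑ l ∈ Finset.range (M - 1 - a),
        (-1 : K) ^ ((a + 1 + l) * e + a * (m + 1)) •
          P.circ (a + 1 + l - 1 + m) d (P.comp a (P.comp (a + 1 + l) x z) y) t := by
    simp only [Finset.smul_sum, smul_smul, ← pow_add]
    refine Finset.sum_congr rfl fun l _ => ?_
    rw [P.comp_par (k := a + 1 + l) (by omega) (by omega) x hy,
      show a + 1 + l - 1 + m = a + m + l by omega]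
    refine congrArg (· • _) (neg_one_pow_congr ?_)
    simp only [Nat.even_add, Nat.even_mul, Nat.not_even_one]
    grind
  rw [h₃, h₄]
  simp only [smul_add]
  rw [smul_smul ((-1 : K) ^ (a * (m + 1))) ((-1 : K) ^ (a * (m + 1))), ← pow_add, ← two_mul,
    (even_two_mul _).neg_one_pow, one_smul]
  simp only [smul_smul, ← pow_add]
  rw [show a * (m + 1) + a * e = a * (e + (m + 1)) by ring,
    show a * (m + 1) + a * (d + e) = a * (m + 1 + d + e) by ring]
  abel

/-! ### The Gerstenhaber bracket and the Jacobi identity -/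

variable (P) in
/-- The Gerstenhaber bracket of elements of arity `m` and `n`. -/
def bracket (m n : ℕ) : T →ₗ[K] T →ₗ[K] T :=
  P.circ m (n + 1) - (-1 : K) ^ ((m + 1) * (n + 1)) • (P.circ n (m + 1)).flip

theorem bracket_apply (m n : ℕ) (x y : T) : P.bracket m n x y
    = P.circ m (n + 1) x y - (-1 : K) ^ ((m + 1) * (n + 1)) • P.circ n (m + 1) y x := rfl

theorem bracket_zero (x y : T) : P.bracket 0 0 x y = 0 := by
  simp [bracket_apply, circ_zero]

theorem bracket_mem {m n k : ℕ} (h : m + n = k + 1) {x y : T} (hx : x ∈ P.homog m)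
    (hy : y ∈ P.homog n) : P.bracket m n x y ∈ P.homog k :=
  Submodule.sub_mem _ (circ_mem h _ _ hx hy)
    (Submodule.smul_mem _ _ (circ_mem (by omega) _ _ hy hx))

theorem bracket_skew (m n : ℕ) (x y : T) : P.bracket m n x y
    = -((-1 : K) ^ ((m + 1) * (n + 1)) • P.bracket n m y x) := by
  simp only [bracket_apply, mul_comm (n + 1) (m + 1)]
  rcases neg_one_pow_eq_or K ((m + 1) * (n + 1)) with h | h <;> rw [h] <;> module

/-- Rewrites the signs through the shifted degrees: a + 1 has the parity of (n + 1) + (p + 1). For n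
= p = 0 the inner bracket vanishes, so `a` may be arbitrary. -/
theorem bracket_bracket_right {m n p a : ℕ} (ha : n + p ≠ 0 → n + p = a + 1) (x y z : T) :
    P.bracket m a x (P.bracket n p y z)
      = P.circ m (n + 1 + (p + 1)) x (P.bracket n p y z)
        - (-1 : K) ^ ((m + 1) * (n + 1 + (p + 1))) •
          P.circ a (m + 1) (P.bracket n p y z) x := by
  by_cases h : n + p = 0
  · obtain ⟨rfl, rfl⟩ : n = 0 ∧ p = 0 := by omega
    simp [bracket_zero]
  · have ha := ha h
    rw [show n + 1 + (p + 1) = a + 1 + 2 by omega, bracket_apply,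
      circ_congr (d := a + 1 + 2) (e := a + 1) (by simp [Nat.even_add]),
      neg_one_pow_congr (a := (m + 1) * (a + 1 + 2)) (b := (m + 1) * (a + 1))
        (by simp [Nat.even_add, Nat.even_mul])]

theorem bracket_bracket_left {m n p a : ℕ} (ha : m + n ≠ 0 → m + n = a + 1) (x y z : T) :
    P.bracket a p (P.bracket m n x y) z
      = P.circ a (p + 1) (P.bracket m n x y) z
        - (-1 : K) ^ ((m + 1 + (n + 1)) * (p + 1)) •
          P.circ p (m + 1 + (n + 1)) z (P.bracket m n x y) := by
  by_cases h : m + n = 0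
  · obtain ⟨rfl, rfl⟩ : m = 0 ∧ n = 0 := by omega
    simp [bracket_zero]
  · have ha := ha h
    rw [show m + 1 + (n + 1) = a + 1 + 2 by omega, bracket_apply,
      circ_congr (d := a + 1 + 2) (e := a + 1) (by simp [Nat.even_add]),
      neg_one_pow_congr (a := (a + 1 + 2) * (p + 1)) (b := (a + 1) * (p + 1))
        (by simp [Nat.even_add, Nat.even_mul])]

/-- The graded Jacobi identity. -/
theorem bracket_jacobi {m n p a b c : ℕ} (ha : n + p ≠ 0 → n + p = a + 1)
    (hb : m + n ≠ 0 → m + n = b + 1) (hc : m + p ≠ 0 → m + p = c + 1) {x y z : T}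
    (hx : x ∈ P.homog m) (hy : y ∈ P.homog n) (hz : z ∈ P.homog p) :
    P.bracket m a x (P.bracket n p y z) = P.bracket b p (P.bracket m n x y) z
      + (-1 : K) ^ ((m + 1) * (n + 1)) • P.bracket n c y (P.bracket m p x z) := by
  -- One pre-Lie identity for each order of the three elements. Exchanging the last two arguments of
  -- an associator permutes its two braces up to sign, so all braces cancel.
  have h₁ := circ_circ (P := P) (M := m) (n := n) (N := b) (by omega) (p + 1) x hy z
  have h₂ := circ_circ (P := P) (M := n) (n := m) (N := b) (by omega) (p + 1) y hx z
  have h₃ := circ_circ (P := P) (M := m) (n := p) (N := c) (by omega) (n + 1) x hz y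
  have h₄ := circ_circ (P := P) (M := p) (n := m) (N := c) (by omega) (n + 1) z hx y
  have h₅ := circ_circ (P := P) (M := n) (n := p) (N := a) (by omega) (m + 1) y hz x
  have h₆ := circ_circ (P := P) (M := p) (n := n) (N := a) (by omega) (m + 1) z hy x
  rw [bracket_bracket_right ha, bracket_bracket_left hb, bracket_bracket_right hc]
  simp only [bracket_apply, map_sub, map_smul, LinearMap.sub_apply, LinearMap.smul_apply, h₁, h₂,
    h₃, h₄, h₅, h₆]
  clear h₁ h₂ h₃ h₄ h₅ h₆
  -- The signs depend only on the parities of the pairwise products of the shifted degrees, which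
  -- leaves eight linear identities.
  generalize m + 1 = u
  generalize n + 1 = v
  generalize p + 1 = w
  simp only [add_comm v u, add_comm w u, add_comm w v, mul_comm v u, mul_comm w u, mul_comm w v,
    mul_add, add_mul, pow_add]
  rcases neg_one_pow_eq_or K (u * v) with h | h <;> rw [h] <;>
  rcases neg_one_pow_eq_or K (u * w) with h | h <;> rw [h] <;>
  rcases neg_one_pow_eq_or K (v * w) with h | h <;> rw [h] <;> module

/-! ### The cup product and its compatibility with ∘ and δ -/

theorem brace_one (d e : ℕ) : P.brace 1 d e = 0 := by
  ext x z y
  simp [brace_apply, circ_zero]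

theorem brace₃_two (d e t : ℕ) : P.brace₃ 2 d e t = 0 := by
  ext x w z y
  simp [brace₃_apply, Finset.sum_range_succ, brace_zero, brace_one]

variable (P) in
/-- The cup product `π(x, y)`. -/
def cup (π : T) : T →ₗ[K] T →ₗ[K] T := (P.comp 0 ∘ₗ P.comp 1 π).flip

theorem cup_apply (π x y : T) : P.cup π x y = P.comp 0 (P.comp 1 π y) x := rfl

theorem brace_two (d e : ℕ) (π x y : T) :
    P.brace 2 d e π y x = (-1 : K) ^ e • P.cup π x y := by
  simp [brace_apply, circ_apply, Finset.sum_range_succ, cup_apply]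

variable {π : T}

theorem cup_mem {m n : ℕ} (hπ : π ∈ P.homog 2) {x y : T} (hx : x ∈ P.homog m)
    (hy : y ∈ P.homog n) : P.cup π x y ∈ P.homog (m + n) :=
  P.comp_mem (m := n + 1) (by omega) 0 (P.comp_mem (by omega) 1 hπ hy) hx

/-- The second insertion carries the sign (-1)^3, so the circle square is the associator of `π`. -/
theorem circ_self (hπ' : P.comp 0 π π = P.comp 1 π π) : P.circ 2 (2 + 1) π π = 0 := by
  simp only [circ_apply, Finset.sum_range_succ, Finset.sum_range_zero, hπ']
  norm_num

/-- Both sides fill the inputs of π ∘₀ π, respectively π ∘₁ π, with `z`, `y`, `x` from right to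
left, so associativity holds already on cochains. -/
theorem cup_assoc (hπ : π ∈ P.homog 2) (hπ' : P.comp 0 π π = P.comp 1 π π) {n p : ℕ} (x : T)
    {y z : T} (hy : y ∈ P.homog n) (hz : z ∈ P.homog p) :
    P.cup π (P.cup π x y) z = P.cup π x (P.cup π y z) := by
  simp only [cup_apply]
  have hy' : P.comp 1 π y ∈ P.homog (n + 1) := P.comp_mem (by omega) 1 hπ hy
  have hz' : P.comp 1 π z ∈ P.homog (p + 1) := P.comp_mem (by omega) 1 hπ hz
  have h₁ := P.comp_seq (i := 0) (j := 0) (by omega) (P.comp 1 π z) hy' x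
  have h₂ := P.comp_seq (i := 0) (j := 1) (by omega) (P.comp 1 π z) hπ y
  have h₃ := P.comp_par (i := 0) (k := 1) (q := 2) (by omega) (by omega) π hπ z
  have h₄ := P.comp_seq (i := 1) (j := 0) (by omega) π hz' y
  have h₅ := P.comp_seq (i := 1) (j := 1) (by omega) π hπ z
  simp only [Nat.add_zero, Nat.zero_add, Nat.reduceAdd] at h₁ h₂ h₄ h₅
  rw [← h₁, ← h₂, ← h₃, ← h₄, ← h₅, hπ']

/-- The Jacobi identity would only give that twice this element vanishes. The pre-Lie identities
give the result in characteristic 2 too: (π ∘ π) ∘ x = 0, and the two copies of x{π, π} in (x ∘ π) ∘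
π have opposite signs. -/
theorem bracket_bracket_self (hπ : π ∈ P.homog 2) (hπ' : P.comp 0 π π = P.comp 1 π π) {n : ℕ}
    {x : T} (hx : x ∈ P.homog n) : P.bracket 2 (n + 1) π (P.bracket 2 n π x) = 0 := by
  have h₁ := circ_circ (P := P) (M := 2) (N := 3) (by omega) (n + 1) π hπ x
  have h₂ := circ_circ (P := P) (M := 2) (N := n + 1) (by omega) (2 + 1) π hx π
  have h₃ := circ_circ (P := P) (M := n) (N := n + 1) (by omega) (2 + 1) x hπ π
  rw [circ_self hπ', map_zero, LinearMap.zero_apply] at h₁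
  rw [circ_self hπ', map_zero] at h₃
  rw [bracket_bracket_right (by omega)]
  simp only [bracket_apply, map_sub, map_smul, LinearMap.sub_apply, LinearMap.smul_apply, h₂, h₃]
  rw [add_comm (2 + 1) (n + 1)]
  rw [add_comm (2 + 1) (n + 1)] at h₁
  rw [eq_comm, add_assoc, ← eq_sub_iff_add_eq] at h₁
  rw [h₁]
  by_cases hn : Even n <;>
  simp only [neg_one_pow_ite, Nat.even_add, Nat.even_mul, hn, Nat.not_even_one, even_two] <;>
  simp <;> module

/-- This is `circ_brace` for π{x, y}: the triple braces of `π` vanish, so no coboundary term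
appears. -/
theorem circ_cup {m n : ℕ} (e : ℕ) {x y : T} (hx : x ∈ P.homog m) (hy : y ∈ P.homog n) (z : T) :
    P.circ (m + n) e (P.cup π x y) z
      = P.cup π (P.circ m e x z) y + (-1 : K) ^ (m * e) • P.cup π x (P.circ n e y z) := by
  have h := circ_brace (P := P) (M := 2) (N := m + n) (by omega) e π hx hy z
  simp only [brace_two, brace₃_two, LinearMap.zero_apply, smul_zero, add_zero, map_smul,
    LinearMap.smul_apply] at h
  have h' := congrArg (fun t => (-1 : K) ^ (n + 1) • t) h
  simp only [smul_add, smul_smul, ← pow_add, ← two_mul, (even_two_mul _).neg_one_pow,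
    one_smul] at h'
  rw [h']
  refine congrArg (_ + · • _) (neg_one_pow_congr ?_)
  simp only [Nat.even_add, Nat.even_mul, Nat.not_even_one]
  grind

/-- Expanding (π ∘ π){x, y} = 0 by `brace_circ` handles π ∘ (x ∪ y), and `circ_cup` handles (x ∪ y)
∘ π. -/
theorem bracket_cup (hπ : π ∈ P.homog 2) (hπ' : P.comp 0 π π = P.comp 1 π π) {m n : ℕ} {x y : T}
    (hx : x ∈ P.homog m) (hy : y ∈ P.homog n) : P.bracket 2 (m + n) π (P.cup π x y)
      = P.cup π x (P.bracket 2 n π y) + (-1 : K) ^ n • P.cup π (P.bracket 2 m π x) y := by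
  have h := brace_circ (P := P) (M := 2) (N := 3) (by omega) (m + 1) (n + 1) π hπ hy x
  rw [circ_self hπ'] at h
  simp only [brace_two, brace₃_two, LinearMap.zero_apply, smul_zero, add_zero, zero_add, map_smul,
    map_zero] at h
  rw [circ_congr (d := 2 + 1 + (m + 1) + (n + 1)) (e := m + n + 1)
    (by simp only [Nat.even_add, Nat.not_even_one, even_two]; grind)] at h
  simp only [bracket_apply, circ_cup _ hx hy, map_sub, map_smul, LinearMap.sub_apply,
    LinearMap.smul_apply]
  have h' : P.circ 2 (m + n + 1) π (P.cup π x y)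
      = P.cup π x (P.circ 2 (n + 1) π y) + (-1 : K) ^ n • P.cup π (P.circ 2 (m + 1) π x) y := by
    by_cases hn : Even n <;>
    simp only [neg_one_pow_ite, Nat.even_add, Nat.even_mul, hn, Nat.not_even_one, even_two] at h ⊢ <;>
    simp at h ⊢ <;>
    first
    | linear_combination (norm := module) h
    | linear_combination (norm := module) -h
  rw [h']
  by_cases hm : Even m <;> by_cases hn : Even n <;>
  simp only [neg_one_pow_ite, Nat.even_add, Nat.even_mul, hm, hn, Nat.not_even_one, even_two] <;>
  simp <;> module

theorem circ_of_cocycle {n : ℕ} {x : T} (hx : P.bracket 2 n π x = 0) :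
    P.circ 2 (n + 1) π x = (-1 : K) ^ (n + 1) • P.circ n (2 + 1) x π := by
  rw [bracket_apply, sub_eq_zero] at hx
  rw [hx]
  refine congrArg (· • _) (neg_one_pow_congr ?_)
  simp only [Nat.even_add, Nat.even_mul, Nat.not_even_one, even_two]
  grind

/-- The cup product of cocycles is graded commutative up to the coboundary of the circle
product. -/
theorem cup_comm (hπ : π ∈ P.homog 2) {m n a : ℕ} (ha : m + n ≠ 0 → m + n = a + 1) {x y : T}
    (hx : x ∈ P.homog m) (hy : y ∈ P.homog n) (hcx : P.bracket 2 m π x = 0)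
    (hcy : P.bracket 2 n π y = 0) :
    P.cup π x y - (-1 : K) ^ (m * n) • P.cup π y x
      = -((-1 : K) ^ (m * (n + 1)) • P.bracket 2 a π (P.circ m (n + 1) x y)) := by
  -- Both cup products arise as the braces of (π ∘ x) ∘ y. The cocycle conditions turn π ∘ x and π ∘
  -- y into x ∘ π and y ∘ π, and the remaining braces x{π, y}, x{y, π} cancel against those of (x ∘
  -- y) ∘ π.
  have h₁ := circ_circ (P := P) (M := 2) (N := m + 1) (by omega) (n + 1) π hx y
  have h₂ := circ_circ (P := P) (M := m) (N := m + 1) (by omega) (n + 1) x hπ y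
  have h₃ := circ_circ (P := P) (M := m) (N := a) (by omega) (2 + 1) x hy π
  rw [circ_of_cocycle hcx, map_smul, LinearMap.smul_apply, h₂, circ_of_cocycle hcy, brace_two,
    brace_two] at h₁
  have h₄ : P.bracket 2 a π (P.circ m (n + 1) x y)
      = P.circ 2 (m + 1 + (n + 1)) π (P.circ m (n + 1) x y)
        - (-1 : K) ^ (m + n) • P.circ a (2 + 1) (P.circ m (n + 1) x y) π := by
    by_cases h : m + n = 0
    · obtain ⟨rfl, rfl⟩ : m = 0 ∧ n = 0 := by omega
      simp [circ_zero]
    · have ha := ha h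
      rw [show m + 1 + (n + 1) = a + 1 + 2 by omega, bracket_apply,
        circ_congr (d := a + 1 + 2) (e := a + 1) (by simp [Nat.even_add]), ha]
      refine congrArg (_ - · • _) (neg_one_pow_congr ?_)
      simp only [Nat.even_add, Nat.even_mul, Nat.not_even_one, even_two]
      grind
  rw [h₄, h₃, add_comm (n + 1) (2 + 1)]
  by_cases hm : Even m <;> by_cases hn : Even n <;>
  simp only [neg_one_pow_ite, Nat.even_add, Nat.even_mul, hm, hn, Nat.not_even_one, even_two]
    at h₁ ⊢ <;>
  simp at h₁ ⊢ <;>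
  first
  | linear_combination (norm := module) h₁
  | linear_combination (norm := module) -h₁

/-- The circle product with a cup product is a derivation up to the coboundary of a brace. -/
theorem circ_cup_right (hπ : π ∈ P.homog 2) {m n p N : ℕ} (hN : 2 ≤ p → p + m + n = N + 2)
    {x y z : T} (hx : x ∈ P.homog m) (hy : y ∈ P.homog n) (hz : z ∈ P.homog p)
    (hcx : P.bracket 2 m π x = 0) (hcy : P.bracket 2 n π y = 0) (hcz : P.bracket 2 p π z = 0) :
    P.circ p (m + n + 1) z (P.cup π x y) - P.cup π x (P.circ p (n + 1) z y)
        - (-1 : K) ^ ((p + 1) * n) • P.cup π (P.circ p (m + 1) z x) y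
      = (-1 : K) ^ (n + p) • P.bracket 2 N π (P.brace p (m + 1) (n + 1) z y x) := by
  -- The cocycle condition on `z` equates (π ∘ z){x, y} and (z ∘ π){x, y} up to sign. The triple
  -- braces of the latter are exactly those of z{x, y} ∘ π, and those on `x` and `y` absorb the
  -- rest.
  have h₁ := brace_circ (P := P) (M := 2) (N := p + 1) (by omega) (m + 1) (n + 1) π hz hy x
  have h₂ := brace_circ (P := P) (M := p) (N := p + 1) (by omega) (m + 1) (n + 1) z hπ hy x
  have h₃ := circ_brace (P := P) (M := p) (N := N) hN (2 + 1) z hx hy π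
  have h₄ : P.bracket 2 N π (P.brace p (m + 1) (n + 1) z y x)
      = P.circ 2 (p + 1 + (m + 1) + (n + 1)) π (P.brace p (m + 1) (n + 1) z y x)
        - (-1 : K) ^ (p + m + n + 1) •
          P.circ N (2 + 1) (P.brace p (m + 1) (n + 1) z y x) π := by
    by_cases h : 2 ≤ p
    · have hN := hN h
      rw [show p + 1 + (m + 1) + (n + 1) = N + 1 + 4 by omega, bracket_apply,
        circ_congr (d := N + 1 + 4) (e := N + 1) (by simp [Nat.even_add, (by decide : Even 4)]), hN]
      refine congrArg (_ - · • _) (neg_one_pow_congr ?_)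
      simp only [Nat.even_add, Nat.even_mul, Nat.not_even_one, even_two]
      grind
    · obtain rfl | rfl : p = 0 ∨ p = 1 := by omega
      · simp [brace_zero]
      · simp [brace_one]
  rw [circ_of_cocycle hcz, map_smul, LinearMap.smul_apply, LinearMap.smul_apply, h₂,
    circ_of_cocycle hcx, circ_of_cocycle hcy] at h₁
  simp only [brace_two, brace₃_two, LinearMap.zero_apply, LinearMap.smul_apply, map_smul, smul_zero,
    add_zero, zero_add] at h₁
  rw [circ_congr (d := 2 + 1 + (m + 1) + (n + 1)) (e := m + n + 1)
    (by simp only [Nat.even_add, Nat.not_even_one, even_two]; grind)] at h₁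
  rw [h₄, h₃, add_comm (m + 1) (2 + 1)]
  by_cases hm : Even m <;> by_cases hn : Even n <;> by_cases hp : Even p <;>
  simp only [neg_one_pow_ite, Nat.even_add, Nat.even_mul, hm, hn, hp, Nat.not_even_one, even_two]
    at h₁ ⊢ <;>
  simp at h₁ ⊢ <;>
  first
  | linear_combination (norm := module) h₁
  | linear_combination (norm := module) -h₁

/-- The Gerstenhaber bracket is a graded derivation of the cup product of cocycles up to a
coboundary. -/
theorem bracket_cup_left (hπ : π ∈ P.homog 2) {m n p N : ℕ} (hN : 2 ≤ p → p + m + n = N + 2)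
    {x y z : T} (hx : x ∈ P.homog m) (hy : y ∈ P.homog n) (hz : z ∈ P.homog p)
    (hcx : P.bracket 2 m π x = 0) (hcy : P.bracket 2 n π y = 0) (hcz : P.bracket 2 p π z = 0) :
    P.bracket (m + n) p (P.cup π x y) z
        - (P.cup π (P.bracket m p x z) y + (-1 : K) ^ (m * (p + 1)) • P.cup π x (P.bracket n p y z))
      = -((-1 : K) ^ ((m + n + 1) * (p + 1) + (n + p)) •
        P.bracket 2 N π (P.brace p (m + 1) (n + 1) z y x)) := by
  have h := circ_cup_right hπ hN hx hy hz hcx hcy hcz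
  rw [pow_add, mul_smul, ← h]
  simp only [bracket_apply, circ_cup _ hx hy, map_sub, map_smul, LinearMap.sub_apply,
    LinearMap.smul_apply]
  by_cases hm : Even m <;> by_cases hn : Even n <;> by_cases hp : Even p <;>
  simp only [neg_one_pow_ite, Nat.even_add, Nat.even_mul, hm, hn, hp, Nat.not_even_one] <;>
  simp <;> module

end TotalOperad

/-! ### The total space of an operad -/

section Bilinear

variable {K : Type u} [Field K] {X : ℕ → Type v} [∀ n, AddCommGroup (X n)] [∀ n, Module K (X n)]
  {E : Type w} [AddCommGroup E] [Module K E]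

/-- The bilinear map on a direct sum with prescribed homogeneous components. -/
def sumBilin (b : ∀ m n, X m →ₗ[K] X n →ₗ[K] E) : (⨁ n, X n) →ₗ[K] (⨁ n, X n) →ₗ[K] E :=
  DirectSum.toModule K ℕ _ fun m => LinearMap.flip <|
    DirectSum.toModule K ℕ _ fun n => LinearMap.flip (b m n)

theorem sumBilin_lof (b : ∀ m n, X m →ₗ[K] X n →ₗ[K] E) {m n : ℕ} (x : X m) (y : X n) :
    sumBilin b (DirectSum.lof K ℕ X m x) (DirectSum.lof K ℕ X n y) = b m n x y := by
  simp [sumBilin, DirectSum.toModule_lof]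

end Bilinear

namespace NSOperad

variable {K : Type u} [Field K] (P : NSOperad.{u, v} K)

/-- The total space of an operad. -/
abbrev Total : Type v := ⨁ n, P.carrier n

/-- The inclusion of the component of arity `n`. -/
abbrev incl (n : ℕ) : P.carrier n →ₗ[K] P.Total := DirectSum.lof K ℕ P.carrier n

variable {P} in
theorem total_induction {p : P.Total → Prop} (x : P.Total)
    (hom : ∀ n (f : P.carrier n), p (P.incl n f)) (add : ∀ x y, p x → p y → p (x + y)) : p x := by
  induction x using DirectSum.induction_on with
  | zero => simpa using hom 0 0
  | of n f => exact hom n f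
  | add x y hx hy => exact add x y hx hy

/-- The partial composition at input `i` on the total space, zero for elements of arity at
most `i`. -/
def tcomp (i : ℕ) : P.Total →ₗ[K] P.Total →ₗ[K] P.Total :=
  sumBilin fun m n => if h : i < m then
    (P.comp (by omega : m + n = (m + n - 1) + 1) ⟨i, h⟩).compr₂ (P.incl (m + n - 1)) else 0

theorem tcomp_incl {m n k : ℕ} (h : m + n = k + 1) (i : Fin m) (f : P.carrier m)
    (g : P.carrier n) : P.tcomp i (P.incl m f) (P.incl n g) = P.incl k (P.comp h i f g) := by
  obtain rfl : k = m + n - 1 := by omega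
  rw [tcomp, sumBilin_lof, dif_pos i.isLt]
  rfl

theorem tcomp_incl_of_le {m i : ℕ} (h : m ≤ i) (f : P.carrier m) (y : P.Total) :
    P.tcomp i (P.incl m f) y = 0 := by
  induction y using total_induction with
  | hom n g => rw [tcomp, sumBilin_lof, dif_neg (by omega)]; rfl
  | add x y hx hy => rw [map_add, hx, hy, add_zero]

/-- The homogeneous elements of arity `n`. -/
def homog (n : ℕ) : Submodule K P.Total := LinearMap.range (P.incl n)

variable {P}

theorem incl_mem_homog {n : ℕ} (f : P.carrier n) : P.incl n f ∈ P.homog n := ⟨f, rfl⟩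

theorem tcomp_eq_zero {m i : ℕ} {x : P.Total} (hx : x ∈ P.homog m) (h : m ≤ i) (y : P.Total) :
    P.tcomp i x y = 0 := by
  obtain ⟨f, rfl⟩ := hx
  exact P.tcomp_incl_of_le h f y

theorem tcomp_mem {m n k : ℕ} (h : m + n = k + 1) (i : ℕ) {x y : P.Total} (hx : x ∈ P.homog m)
    (hy : y ∈ P.homog n) : P.tcomp i x y ∈ P.homog k := by
  by_cases hi : i < m
  · obtain ⟨f, rfl⟩ := hx
    obtain ⟨g, rfl⟩ := hy
    rw [P.tcomp_incl h ⟨i, hi⟩]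
    exact incl_mem_homog _
  · rw [tcomp_eq_zero hx (by omega)]
    exact zero_mem _

theorem tcomp_seq {n i j : ℕ} (hj : j < n) (x : P.Total) {y : P.Total} (hy : y ∈ P.homog n)
    (z : P.Total) : P.tcomp (i + j) (P.tcomp i x y) z = P.tcomp i x (P.tcomp j y z) := by
  obtain ⟨g, rfl⟩ := hy
  induction x using total_induction with
  | add x y hx hy => simp only [map_add, LinearMap.add_apply, hx, hy]
  | hom m f =>
    induction z using total_induction with
    | add x y hx hy => simp only [map_add, hx, hy]
    | hom p e =>
      by_cases hi : i < m
      · rw [P.tcomp_incl (k := m + n - 1) (by omega) ⟨i, hi⟩,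
          P.tcomp_incl (k := m + n + p - 2) (by omega) ⟨i + j, by omega⟩,
          P.tcomp_incl (k := n + p - 1) (by omega) ⟨j, hj⟩,
          P.tcomp_incl (k := m + n + p - 2) (by omega) ⟨i, hi⟩]
        congr 1
        exact P.comp_seq _ _ _ _ ⟨i, hi⟩ ⟨j, hj⟩ f g e
      · rw [P.tcomp_incl_of_le (by omega), P.tcomp_incl_of_le (by omega), map_zero,
          LinearMap.zero_apply]

theorem tcomp_par {n i k q : ℕ} (hik : i < k) (hq : q + 1 = k + n) (x : P.Total) {y : P.Total}
    (hy : y ∈ P.homog n) (z : P.Total) :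
    P.tcomp q (P.tcomp i x y) z = P.tcomp i (P.tcomp k x z) y := by
  obtain ⟨g, rfl⟩ := hy
  obtain rfl : q = k + n - 1 := by omega
  induction x using total_induction with
  | add x y hx hy => simp only [map_add, LinearMap.add_apply, hx, hy]
  | hom m f =>
    induction z using total_induction with
    | add x y hx hy => simp only [map_add, LinearMap.add_apply, hx, hy]
    | hom p e =>
      by_cases hk : k < m
      · rw [P.tcomp_incl (k := m + n - 1) (by omega) ⟨i, by omega⟩,
          P.tcomp_incl (k := m + n + p - 2) (by omega) ⟨k + n - 1, by omega⟩,
          P.tcomp_incl (k := m + p - 1) (by omega) ⟨k, hk⟩,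
          P.tcomp_incl (k := m + n + p - 2) (by omega) ⟨i, by omega⟩]
        congr 1
        exact P.comp_par _ _ _ _ ⟨i, by omega⟩ ⟨k, hk⟩ hik f g e
      -- Here k is not an input of `f`. On the left, either i is not one either, or the shifted slot
      -- lies beyond the arity of f ∘ᵢ g.
      · rw [P.tcomp_incl_of_le (m := m) (i := k) (by omega), map_zero, LinearMap.zero_apply]
        by_cases hi : i < m
        · rw [P.tcomp_incl (k := m + n - 1) (by omega) ⟨i, hi⟩, P.tcomp_incl_of_le (by omega)]
        · rw [P.tcomp_incl_of_le (by omega), map_zero, LinearMap.zero_apply]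

variable (P) in
/-- The total space of an operad with its partial compositions. -/
def total : TotalOperad K P.Total where
  comp := P.tcomp
  homog := P.homog
  comp_eq_zero := tcomp_eq_zero
  comp_mem := tcomp_mem
  comp_seq := tcomp_seq
  comp_par := tcomp_par

theorem incl_mem {n : ℕ} (f : P.carrier n) : P.incl n f ∈ P.total.homog n := ⟨f, rfl⟩

theorem exists_incl {n : ℕ} {x : P.Total} (hx : x ∈ P.total.homog n) : ∃ f, P.incl n f = x := hx

theorem incl_injective (n : ℕ) : Function.Injective (P.incl n) := DirectSum.of_injective n

theorem total_comp_incl {m n k : ℕ} (h : m + n = k + 1) (i : Fin m) (f : P.carrier m)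
    (g : P.carrier n) :
    P.total.comp i (P.incl m f) (P.incl n g) = P.incl k (P.comp h i f g) := P.tcomp_incl h i f g

theorem total_circ_incl {m n k : ℕ} (h : m + n = k + 1) (d : ℕ) (f : P.carrier m)
    (g : P.carrier n) : P.total.circ m d (P.incl m f) (P.incl n g)
      = P.incl k (∑ i : Fin m, (-1 : K) ^ (i.val * d) • P.comp h i f g) := by
  rw [TotalOperad.circ_apply, Finset.sum_range, map_sum]
  refine Finset.sum_congr rfl fun i _ => ?_
  rw [total_comp_incl h, map_smul]

theorem total_bracket_incl {m n k : ℕ} (h : m + n = k + 1) (f : P.carrier m)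
    (g : P.carrier n) : P.total.bracket m n (P.incl m f) (P.incl n g)
      = P.incl k (P.bracket h f g) := by
  rw [TotalOperad.bracket_apply, total_circ_incl h, total_circ_incl (by omega : n + m = k + 1),
    bracket, map_sub, map_smul]
  rfl

namespace Multiplication

variable (π : P.Multiplication)

/-- The multiplication as an element of the total space. -/
def tval : P.Total := P.incl 2 π.val

theorem tval_mem : π.tval ∈ P.total.homog 2 := incl_mem _

theorem tval_assoc : P.total.comp 0 π.tval π.tval = P.total.comp 1 π.tval π.tval := by
  have h₀ := P.total_comp_incl (rfl : 2 + 2 = 3 + 1) 0 π.val π.val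
  have h₁ := P.total_comp_incl (rfl : 2 + 2 = 3 + 1) 1 π.val π.val
  rw [π.assoc, ← h₁] at h₀
  exact h₀

theorem total_cup_incl {m n k : ℕ} (h : m + n = k) (f : P.carrier m) (g : P.carrier n) :
    P.total.cup π.tval (P.incl m f) (P.incl n g) = P.incl k (π.cup h f g) := by
  rw [TotalOperad.cup_apply, cup]
  have h₁ := P.total_comp_incl (by omega : 2 + n = (n + 1) + 1) 1 π.val g
  have h₂ := P.total_comp_incl (by omega : (n + 1) + m = k + 1) 0
    (P.comp (by omega : 2 + n = (n + 1) + 1) 1 π.val g) f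
  rw [← h₁] at h₂
  exact h₂

/-- In π ∘ f the second insertion has sign (-1)^(n+1), whereas in δ it is the first one; the global
factor exchanges the two. -/
theorem incl_delta {n : ℕ} (f : P.carrier n) : P.incl (n + 1) (π.delta n f)
    = (-1 : K) ^ (n + 1) • P.total.bracket 2 n π.tval (P.incl n f) := by
  have h₁ := P.total_circ_incl (by omega : 2 + n = (n + 1) + 1) (n + 1) π.val f
  have h₂ := P.total_circ_incl (by omega : n + 2 = (n + 1) + 1) (2 + 1) f π.val
  rw [TotalOperad.bracket_apply, tval, h₁, h₂, ← map_smul, ← map_sub, ← map_smul, delta]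
  refine congrArg _ ?_
  have h₃ : ∑ i : Fin n, (-1 : K) ^ (i.val + 1) • P.comp (rfl : n + 2 = (n + 1) + 1) i f π.val
      = -∑ i : Fin n, (-1 : K) ^ (i.val * (2 + 1)) •
        P.comp (by omega : n + 2 = (n + 1) + 1) i f π.val := by
    rw [← Finset.sum_neg_distrib]
    refine Finset.sum_congr rfl fun i _ => ?_
    rw [pow_succ, pow_mul']
    norm_num
  simp only [LinearMap.add_apply, LinearMap.sum_apply, LinearMap.smul_apply, LinearMap.flip_apply]
  rw [h₃, Fin.sum_univ_two]
  by_cases hn : Even n <;>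
  simp only [neg_one_pow_ite, Nat.even_add, Nat.even_mul, hn, Nat.not_even_one, even_two,
    Fin.val_zero, Fin.val_one] <;>
  simp <;> abel

theorem total_bracket_eq_zero_iff {n : ℕ} {f : P.carrier n} :
    P.total.bracket 2 n π.tval (P.incl n f) = 0 ↔ f ∈ π.cocycles n := by
  rw [LinearMap.mem_ker, ← (incl_injective (P := P) (n + 1)).eq_iff, incl_delta, map_zero,
    smul_eq_zero_iff_right (pow_ne_zero _ (by norm_num))]

theorem delta_delta (n : ℕ) (f : P.carrier n) : π.delta (n + 1) (π.delta n f) = 0 := by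
  refine π.total_bracket_eq_zero_iff.mp ?_
  rw [incl_delta, map_smul,
    TotalOperad.bracket_bracket_self π.tval_mem π.tval_assoc (incl_mem f), smul_zero]

end Multiplication

end NSOperad

/-! ### Descent of operations to cohomology -/

/-- The bilinear map on quotients induced by a bilinear map. -/
def quotBilin {K : Type*} [Field K] {U W E : Type*} [AddCommGroup U] [Module K U] [AddCommGroup W]
    [Module K W] [AddCommGroup E] [Module K E] (N : Submodule K U) (N' : Submodule K W)
    (b : U →ₗ[K] W →ₗ[K] E) (h : ∀ u ∈ N, ∀ w, b u w = 0) (h' : ∀ u, ∀ w ∈ N', b u w = 0) :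
    (U ⧸ N) →ₗ[K] (W ⧸ N') →ₗ[K] E :=
  N.liftQ (N'.liftQ b.flip fun w hw => LinearMap.ext fun u => h' u w hw).flip fun u hu => by
    refine LinearMap.mem_ker.mpr (Submodule.linearMap_qext _ (LinearMap.ext fun w => ?_))
    exact h u hu w

namespace NSOperad

variable {K : Type u} [Field K] {P : NSOperad.{u, v} K}

namespace Multiplication

variable (π : P.Multiplication)

theorem bracket_mem_homog {m n k : ℕ} (h : m + n ≠ 0 → m + n = k + 1) {x y : P.Total}
    (hx : x ∈ P.total.homog m) (hy : y ∈ P.total.homog n) :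
    P.total.bracket m n x y ∈ P.total.homog k := by
  by_cases h' : m + n = 0
  · obtain ⟨rfl, rfl⟩ : m = 0 ∧ n = 0 := by omega
    rw [TotalOperad.bracket_zero]
    exact zero_mem _
  · exact TotalOperad.bracket_mem (h h') hx hy

/-- The homogeneous cocycles in the total space. -/
def tcocycles (n : ℕ) : Submodule K P.Total :=
  P.total.homog n ⊓ LinearMap.ker (P.total.bracket 2 n π.tval)

variable {π}

theorem incl_mem_tcocycles {n : ℕ} {f : P.carrier n} :
    P.incl n f ∈ π.tcocycles n ↔ f ∈ π.cocycles n := by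
  rw [← total_bracket_eq_zero_iff, tcocycles, Submodule.mem_inf, LinearMap.mem_ker]
  exact and_iff_right (incl_mem f)

theorem exists_cocycle {n : ℕ} {x : P.Total} (hx : x ∈ π.tcocycles n) :
    ∃ f : π.cocycles n, P.incl n f = x := by
  obtain ⟨f, rfl⟩ := exists_incl hx.1
  exact ⟨⟨f, incl_mem_tcocycles.mp hx⟩, rfl⟩

theorem cup_mem_tcocycles {m n : ℕ} {x y : P.Total} (hx : x ∈ π.tcocycles m)
    (hy : y ∈ π.tcocycles n) : P.total.cup π.tval x y ∈ π.tcocycles (m + n) := by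
  refine ⟨TotalOperad.cup_mem π.tval_mem hx.1 hy.1, LinearMap.mem_ker.mpr ?_⟩
  rw [TotalOperad.bracket_cup π.tval_mem π.tval_assoc hx.1 hy.1, LinearMap.mem_ker.mp hx.2,
    LinearMap.mem_ker.mp hy.2]
  simp

/-- The Jacobi identity with `π` in front makes [π, -] a derivation of the bracket. -/
theorem bracket_mem_tcocycles {m n k : ℕ} (h : m + n ≠ 0 → m + n = k + 1) {x y : P.Total}
    (hx : x ∈ π.tcocycles m) (hy : y ∈ π.tcocycles n) :
    P.total.bracket m n x y ∈ π.tcocycles k := by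
  refine ⟨bracket_mem_homog h hx.1 hy.1, LinearMap.mem_ker.mpr ?_⟩
  rw [TotalOperad.bracket_jacobi (b := m + 1) (c := n + 1) h (by omega) (by omega) π.tval_mem hx.1
    hy.1, LinearMap.mem_ker.mp hx.2, LinearMap.mem_ker.mp hy.2]
  simp

-- Over a field a linear map on a subspace extends. The choice outside the cocycles is immaterial,
-- as only values on cocycles are used.
variable (π) in
theorem exists_extension (n : ℕ) :
    ∃ g : P.carrier n →ₗ[K] π.cohomology n, g ∘ₗ (π.cocycles n).subtype = π.cls n :=
  LinearMap.exists_extend _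

variable (π) in
/-- A linear map on the total space that sends each homogeneous cocycle to its class. -/
def classMap : P.Total →ₗ[K] ⨁ n, π.cohomology n :=
  DirectSum.toModule K ℕ _ fun n =>
    DirectSum.lof K ℕ π.cohomology n ∘ₗ (π.exists_extension n).choose

theorem classMap_incl {n : ℕ} (f : π.cocycles n) :
    π.classMap (P.incl n f) = π.totalCls n f := by
  rw [classMap, incl, DirectSum.toModule_lof, LinearMap.comp_apply, totalCls, LinearMap.comp_apply]
  exact congrArg _ (LinearMap.congr_fun (π.exists_extension n).choose_spec f)

theorem classMap_mem {n : ℕ} {x : P.Total} (hx : x ∈ π.tcocycles n) :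
    π.classMap x ∈ LinearMap.range (DirectSum.lof K ℕ π.cohomology n) := by
  obtain ⟨f, rfl⟩ := exists_cocycle hx
  rw [classMap_incl]
  exact ⟨_, rfl⟩

theorem exists_classMap {n : ℕ} (c : π.cohomology n) :
    ∃ x ∈ π.tcocycles n, π.classMap x = DirectSum.lof K ℕ π.cohomology n c := by
  obtain ⟨f, rfl⟩ := Submodule.mkQ_surjective _ c
  exact ⟨P.incl n f, incl_mem_tcocycles.mpr f.2, classMap_incl f⟩

theorem totalCls_eq_zero {n : ℕ} {f : π.cocycles n} (hf : f.val ∈ π.coboundaries n) :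
    π.totalCls n f = 0 := by
  have : π.cls n f = 0 := (Submodule.Quotient.mk_eq_zero _).mpr hf
  rw [totalCls, LinearMap.comp_apply, this, map_zero]

/-- Turns each identity up to a term [π, x] on cochains into an equality of classes. -/
theorem classMap_bracket_self {n : ℕ} {x : P.Total} (hx : x ∈ P.total.homog n) :
    π.classMap (P.total.bracket 2 n π.tval x) = 0 := by
  obtain ⟨f, rfl⟩ := exists_incl hx
  have h : (-1 : K) ^ (n + 1) ≠ 0 := pow_ne_zero _ (by norm_num)
  rw [← smul_eq_zero_iff_right h, ← map_smul, ← incl_delta]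
  exact (classMap_incl ⟨_, LinearMap.mem_ker.mpr (π.delta_delta n f)⟩).trans
    (totalCls_eq_zero ⟨f, rfl⟩)

theorem incl_coboundary {n : ℕ} {f : P.carrier n} (hf : f ∈ π.coboundaries n) :
    P.incl n f = 0 ∨ ∃ k, n = k + 1 ∧ ∃ x ∈ P.total.homog k,
      P.incl n f = P.total.bracket 2 k π.tval x := by
  cases n with
  | zero =>
    left
    rw [show f = 0 from hf, map_zero]
  | succ k =>
    obtain ⟨g, rfl⟩ := hf
    refine Or.inr ⟨k, rfl, (-1 : K) ^ (k + 1) • P.incl k g,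
      Submodule.smul_mem _ _ (incl_mem g), ?_⟩
    rw [incl_delta, map_smul]

section Induced

variable (b : ℕ → ℕ → P.Total →ₗ[K] P.Total →ₗ[K] P.Total)
  (hb₁ : ∀ m n, ∀ x ∈ P.total.homog m, ∀ y ∈ π.tcocycles n,
    π.classMap (b (m + 1) n (P.total.bracket 2 m π.tval x) y) = 0)
  (hb₂ : ∀ m n, ∀ x ∈ π.tcocycles m, ∀ y ∈ P.total.homog n,
    π.classMap (b m (n + 1) x (P.total.bracket 2 n π.tval y)) = 0)

/-- The component of arities `m` and `n` of the induced operation on cohomology. -/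
def inducedComponent (m n : ℕ) :
    π.cohomology m →ₗ[K] π.cohomology n →ₗ[K] ⨁ n, π.cohomology n :=
  quotBilin (E := ⨁ n, π.cohomology n) ((π.coboundaries m).submoduleOf (π.cocycles m))
    ((π.coboundaries n).submoduleOf (π.cocycles n))
    (((b m n).compr₂ π.classMap).compl₁₂ (P.incl m ∘ₗ (π.cocycles m).subtype)
      (P.incl n ∘ₗ (π.cocycles n).subtype))
    (fun f hf g => by
      change π.classMap (b m n (P.incl m f) (P.incl n g)) = 0
      rcases incl_coboundary (f := f.val) hf with h | ⟨k, rfl, x, hx, h⟩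
      · rw [h, map_zero, LinearMap.zero_apply, map_zero]
      · rw [h]
        exact hb₁ k n x hx _ (incl_mem_tcocycles.mpr g.2))
    (fun f g hg => by
      change π.classMap (b m n (P.incl m f) (P.incl n g)) = 0
      rcases incl_coboundary (f := g.val) hg with h | ⟨k, rfl, x, hx, h⟩
      · rw [h, map_zero, map_zero]
      · rw [h]
        exact hb₂ m k _ (incl_mem_tcocycles.mpr f.2) x hx)

/-- The operation on cohomology induced by a family of bilinear operations on the total space. -/
def induced : (⨁ n, π.cohomology n) →ₗ[K] (⨁ n, π.cohomology n) →ₗ[K] ⨁ n, π.cohomology n :=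
  sumBilin (E := ⨁ n, π.cohomology n) (inducedComponent b hb₁ hb₂)

theorem induced_classMap {m n : ℕ} {x y : P.Total} (hx : x ∈ π.tcocycles m)
    (hy : y ∈ π.tcocycles n) :
    induced b hb₁ hb₂ (π.classMap x) (π.classMap y) = π.classMap (b m n x y) := by
  obtain ⟨f, rfl⟩ := exists_cocycle hx
  obtain ⟨g, rfl⟩ := exists_cocycle hy
  rw [classMap_incl, classMap_incl]
  exact sumBilin_lof _ _ _

end Induced

variable (π)

/-- The cup product on cohomology. -/
def cohomologyMul :
    (⨁ n, π.cohomology n) →ₗ[K] (⨁ n, π.cohomology n) →ₗ[K] ⨁ n, π.cohomology n :=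
  induced (fun _ _ => P.total.cup π.tval)
    (fun m n x hx y hy => by
      -- As `y` is a cocycle, the derivation rule leaves [π, x ∪ y] = ±[π, x] ∪ y.
      have h := TotalOperad.bracket_cup π.tval_mem π.tval_assoc hx hy.1
      rw [LinearMap.mem_ker.mp hy.2, map_zero, zero_add] at h
      have h' := classMap_bracket_self (π := π) (TotalOperad.cup_mem π.tval_mem hx hy.1)
      rwa [h, map_smul, smul_eq_zero_iff_right (pow_ne_zero _ (by norm_num))] at h')
    (fun m n x hx y hy => by
      have h := TotalOperad.bracket_cup π.tval_mem π.tval_assoc hx.1 hy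
      rw [LinearMap.mem_ker.mp hx.2, map_zero, LinearMap.zero_apply, smul_zero, add_zero] at h
      rw [← h]
      exact classMap_bracket_self (TotalOperad.cup_mem π.tval_mem hx.1 hy))

-- When [π, y] = 0, the Jacobi identity reduces to [[π, x], y] = [π, [x, y]].
variable {π} in
theorem classMap_bracket_coboundary {m n : ℕ} {x y : P.Total} (hx : x ∈ P.total.homog m)
    (hy : y ∈ π.tcocycles n) :
    π.classMap (P.total.bracket (m + 1) n (P.total.bracket 2 m π.tval x) y) = 0 := by
  have h := TotalOperad.bracket_jacobi (a := m + n - 1) (b := m + 1) (c := n + 1) (by omega)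
    (by omega) (by omega) π.tval_mem hx hy.1
  rw [LinearMap.mem_ker.mp hy.2, map_zero, smul_zero, add_zero] at h
  rw [← h]
  exact classMap_bracket_self (bracket_mem_homog (by omega) hx hy.1)

/-- The Gerstenhaber bracket on cohomology. -/
def cohomologyBracket :
    (⨁ n, π.cohomology n) →ₗ[K] (⨁ n, π.cohomology n) →ₗ[K] ⨁ n, π.cohomology n :=
  induced P.total.bracket (fun m n x hx y hy => classMap_bracket_coboundary hx hy)
    (fun m n x hx y hy => by
      rw [TotalOperad.bracket_skew, map_neg, map_smul, classMap_bracket_coboundary hy hx,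
        smul_zero, neg_zero])

variable {π}

theorem cohomologyMul_classMap {m n : ℕ} {x y : P.Total} (hx : x ∈ π.tcocycles m)
    (hy : y ∈ π.tcocycles n) : π.cohomologyMul (π.classMap x) (π.classMap y)
      = π.classMap (P.total.cup π.tval x y) := induced_classMap _ _ _ hx hy

theorem cohomologyBracket_classMap {m n : ℕ} {x y : P.Total} (hx : x ∈ π.tcocycles m)
    (hy : y ∈ π.tcocycles n) : π.cohomologyBracket (π.classMap x) (π.classMap y)
      = π.classMap (P.total.bracket m n x y) := induced_classMap _ _ _ hx hy

variable (π)

theorem classMap_induction {p : (⨁ n, π.cohomology n) → Prop} (c : ⨁ n, π.cohomology n)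
    (hom : ∀ n, ∀ x ∈ π.tcocycles n, p (π.classMap x))
    (add : ∀ c d, p c → p d → p (c + d)) : p c := by
  induction c using DirectSum.induction_on with
  | zero =>
    rw [← map_zero π.classMap]
    exact hom 0 0 (zero_mem _)
  | of n c =>
    obtain ⟨x, hx, h⟩ := exists_classMap c
    have := hom n x hx
    rw [h] at this
    exact this
  | add c d hc hd => exact add c d hc hd

theorem cohomologyMul_assoc (a b c : ⨁ n, π.cohomology n) :
    π.cohomologyMul (π.cohomologyMul a b) c = π.cohomologyMul a (π.cohomologyMul b c) := by
  induction a using π.classMap_induction with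
  | add a a' h h' => simp only [map_add, LinearMap.add_apply, h, h']
  | hom m x hx =>
    induction b using π.classMap_induction with
    | add b b' h h' => simp only [map_add, LinearMap.add_apply, h, h']
    | hom n y hy =>
      induction c using π.classMap_induction with
      | add c c' h h' => simp only [map_add, h, h']
      | hom p z hz =>
        rw [cohomologyMul_classMap hx hy, cohomologyMul_classMap hy hz,
          cohomologyMul_classMap (cup_mem_tcocycles hx hy) hz,
          cohomologyMul_classMap hx (cup_mem_tcocycles hy hz),
          TotalOperad.cup_assoc π.tval_mem π.tval_assoc x hy.1 hz.1]

/-! ### The Gerstenhaber algebra on cohomology -/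

/-- The Gerstenhaber algebra structure on the cohomology of an operad with multiplication. -/
def gerstenhaberAlgebra : GerstenhaberAlgebra K π.cohomology where
  mul := π.cohomologyMul
  bracket := π.cohomologyBracket
  mul_degree m n c d := by
    obtain ⟨x, hx, h⟩ := exists_classMap c
    obtain ⟨y, hy, h'⟩ := exists_classMap d
    rw [← h, ← h', cohomologyMul_classMap hx hy]
    exact classMap_mem (cup_mem_tcocycles hx hy)
  bracket_degree m n k hk c d := by
    obtain ⟨x, hx, h⟩ := exists_classMap c
    obtain ⟨y, hy, h'⟩ := exists_classMap d
    rw [← h, ← h', cohomologyBracket_classMap hx hy]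
    exact classMap_mem (bracket_mem_tcocycles (fun _ => hk) hx hy)
  bracket_degree_zero c d := by
    obtain ⟨x, hx, h⟩ := exists_classMap c
    obtain ⟨y, hy, h'⟩ := exists_classMap d
    rw [← h, ← h', cohomologyBracket_classMap hx hy, TotalOperad.bracket_zero, map_zero]
  mul_assoc := π.cohomologyMul_assoc
  mul_comm m n c d := by
    obtain ⟨x, hx, h⟩ := exists_classMap c
    obtain ⟨y, hy, h'⟩ := exists_classMap d
    rw [← h, ← h', cohomologyMul_classMap hx hy, cohomologyMul_classMap hy hx, ← sub_eq_zero,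
      ← map_smul, ← map_sub, TotalOperad.cup_comm (a := m + n - 1) π.tval_mem (by omega) hx.1 hy.1
      hx.2 hy.2, map_neg, map_smul, neg_eq_zero]
    refine smul_eq_zero_of_right _ ?_
    -- In arities 0 and 0 the circle product is an empty sum, and m + n - 1 is not its arity.
    by_cases h0 : m + n = 0
    · obtain ⟨rfl, rfl⟩ : m = 0 ∧ n = 0 := by omega
      simp [TotalOperad.circ_zero]
    · exact classMap_bracket_self (TotalOperad.circ_mem (by omega) _ _ hx.1 hy.1)
  bracket_skew m n c d := by
    obtain ⟨x, hx, h⟩ := exists_classMap c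
    obtain ⟨y, hy, h'⟩ := exists_classMap d
    rw [← h, ← h', cohomologyBracket_classMap hx hy, cohomologyBracket_classMap hy hx,
      TotalOperad.bracket_skew, map_neg, map_smul]
  jacobi m n p c d e := by
    obtain ⟨x, hx, h⟩ := exists_classMap c
    obtain ⟨y, hy, h'⟩ := exists_classMap d
    obtain ⟨z, hz, h''⟩ := exists_classMap e
    have ha : n + p ≠ 0 → n + p = (n + p - 1) + 1 := by omega
    have hb : m + n ≠ 0 → m + n = (m + n - 1) + 1 := by omega
    have hc : m + p ≠ 0 → m + p = (m + p - 1) + 1 := by omega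
    rw [← h, ← h', ← h'', cohomologyBracket_classMap hy hz, cohomologyBracket_classMap hx hy,
      cohomologyBracket_classMap hx hz,
      cohomologyBracket_classMap hx (bracket_mem_tcocycles ha hy hz),
      cohomologyBracket_classMap (bracket_mem_tcocycles hb hx hy) hz,
      cohomologyBracket_classMap hy (bracket_mem_tcocycles hc hx hz),
      TotalOperad.bracket_jacobi ha hb hc hx.1 hy.1 hz.1, map_add, map_smul]
  leibniz m n p c d e := by
    obtain ⟨x, hx, h⟩ := exists_classMap c
    obtain ⟨y, hy, h'⟩ := exists_classMap d
    obtain ⟨z, hz, h''⟩ := exists_classMap e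
    have hb : n + p ≠ 0 → n + p = (n + p - 1) + 1 := by omega
    have hc : m + p ≠ 0 → m + p = (m + p - 1) + 1 := by omega
    rw [← h, ← h', ← h'', cohomologyMul_classMap hx hy, cohomologyBracket_classMap hx hz,
      cohomologyBracket_classMap hy hz,
      cohomologyBracket_classMap (cup_mem_tcocycles hx hy) hz,
      cohomologyMul_classMap (bracket_mem_tcocycles hc hx hz) hy,
      cohomologyMul_classMap hx (bracket_mem_tcocycles hb hy hz), ← map_smul, ← map_add,
      ← sub_eq_zero, ← map_sub, TotalOperad.bracket_cup_left (N := p + m + n - 2) π.tval_mem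
        (by omega) hx.1 hy.1 hz.1 hx.2 hy.2 hz.2, map_neg, map_smul, neg_eq_zero]
    refine smul_eq_zero_of_right _ ?_
    -- With fewer than two inputs `z` admits no brace, and the error term is zero.
    by_cases hp : 2 ≤ p
    · exact classMap_bracket_self (TotalOperad.brace_mem (by omega) _ _ _ hx.1 hy.1 hz.1)
    · obtain rfl | rfl : p = 0 ∨ p = 1 := by omega
      · simp [TotalOperad.brace_zero]
      · simp [TotalOperad.brace_one]

theorem gerstenhaberAlgebra_isInducedBy : π.gerstenhaberAlgebra.IsInducedBy where
  mul_cls m n k h f g := by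
    subst h
    have hf := incl_mem_tcocycles.mpr f.2
    have hg := incl_mem_tcocycles.mpr g.2
    have hc := cup_mem_tcocycles hf hg
    have h := cohomologyMul_classMap hf hg
    rw [total_cup_incl π rfl] at hc h
    refine ⟨incl_mem_tcocycles.mp hc, ?_⟩
    rw [← classMap_incl, ← classMap_incl, ← classMap_incl]
    exact h
  bracket_cls m n k hk f g := by
    have hf := incl_mem_tcocycles.mpr f.2
    have hg := incl_mem_tcocycles.mpr g.2
    have hc := bracket_mem_tcocycles (fun _ => hk) hf hg
    have h := cohomologyBracket_classMap hf hg
    rw [total_bracket_incl hk] at hc h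
    refine ⟨incl_mem_tcocycles.mp hc, ?_⟩
    rw [← classMap_incl, ← classMap_incl, ← classMap_incl]
    exact h

variable {π}

theorem totalCls_induction {p : (⨁ n, π.cohomology n) → Prop} (c : ⨁ n, π.cohomology n)
    (hom : ∀ n (f : π.cocycles n), p (π.totalCls n f))
    (add : ∀ c d, p c → p d → p (c + d)) : p c := by
  refine π.classMap_induction c (fun n x hx => ?_) add
  obtain ⟨f, rfl⟩ := exists_cocycle hx
  rw [classMap_incl]
  exact hom n f

end Multiplication

end NSOperad

/-! ### Functoriality for morphisms of operads with multiplication -/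

namespace IsOperadHom

open NSOperad

variable {K : Type u} [Field K] {P : NSOperad.{u, v} K} {Q : NSOperad.{u, w} K}
  {F : ∀ n, P.carrier n →ₗ[K] Q.carrier n} (hF : IsOperadHom P Q F)

include hF

theorem map_circ {m n k : ℕ} (h : m + n = k + 1) (f : P.carrier m) (g : P.carrier n) :
    F k (P.circ h f g) = Q.circ h (F m f) (F n g) := by
  simp only [circ, map_sum, map_smul, hF.map_comp]

theorem map_bracket {m n k : ℕ} (h : m + n = k + 1) (f : P.carrier m) (g : P.carrier n) :
    F k (P.bracket h f g) = Q.bracket h (F m f) (F n g) := by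
  simp only [bracket, map_sub, map_smul, hF.map_circ]

variable {π : P.Multiplication} {θ : Q.Multiplication} (hπ : F 2 π.val = θ.val)

include hπ

theorem map_cup {m n k : ℕ} (h : m + n = k) (f : P.carrier m) (g : P.carrier n) :
    F k (π.cup h f g) = θ.cup h (F m f) (F n g) := by
  simp only [Multiplication.cup, hF.map_comp, hπ]

theorem map_delta (n : ℕ) (f : P.carrier n) :
    F (n + 1) (π.delta n f) = θ.delta n (F n f) := by
  simp only [Multiplication.delta, LinearMap.add_apply, LinearMap.sum_apply, LinearMap.smul_apply,
    LinearMap.flip_apply, map_add, map_sum, map_smul, hF.map_comp, hπ]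

theorem map_cocycles {n : ℕ} {f : P.carrier n} (hf : f ∈ π.cocycles n) :
    F n f ∈ θ.cocycles n := by
  rw [LinearMap.mem_ker] at hf ⊢
  rw [← hF.map_delta hπ, hf, map_zero]

theorem map_coboundaries {n : ℕ} {f : P.carrier n} (hf : f ∈ π.coboundaries n) :
    F n f ∈ θ.coboundaries n := by
  cases n with
  | zero =>
    rw [show f = 0 from hf, map_zero]
    exact zero_mem _
  | succ n =>
    obtain ⟨g, rfl⟩ := hf
    exact ⟨F n g, (hF.map_delta hπ n g).symm⟩

/-- The map induced on cohomology by a morphism of operads with multiplication. -/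
def cohomologyMap (n : ℕ) : π.cohomology n →ₗ[K] θ.cohomology n :=
  Submodule.mapQ _ _ ((F n).restrict (p := π.cocycles n) (q := θ.cocycles n)
    fun _ hf => hF.map_cocycles hπ hf) fun _ hf => hF.map_coboundaries hπ hf

theorem cohomologyMap_cls (n : ℕ) (f : π.cocycles n) :
    hF.cohomologyMap hπ n (π.cls n f) = θ.cls n ⟨F n f.val, hF.map_cocycles hπ f.2⟩ := rfl

theorem lmap_totalCls (n : ℕ) (f : π.cocycles n) :
    DirectSum.lmap (hF.cohomologyMap hπ) (π.totalCls n f)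
      = θ.totalCls n ⟨F n f.val, hF.map_cocycles hπ f.2⟩ := by
  rw [Multiplication.totalCls, LinearMap.comp_apply, DirectSum.lmap_lof, cohomologyMap_cls]
  rfl

/-- A morphism of operads with multiplication induces a morphism of Gerstenhaber algebras. -/
theorem isHom {A : GerstenhaberAlgebra K π.cohomology} {B : GerstenhaberAlgebra K θ.cohomology}
    (hA : A.IsInducedBy) (hB : B.IsInducedBy) :
    GerstenhaberAlgebra.IsHom A B (hF.cohomologyMap hπ) where
  map_mul c d := by
    induction c using Multiplication.totalCls_induction with
    | add c c' h h' => simp only [map_add, LinearMap.add_apply, h, h']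
    | hom m f =>
      induction d using Multiplication.totalCls_induction with
      | add d d' h h' => simp only [map_add, h, h']
      | hom n g =>
        obtain ⟨hc, h⟩ := hA.mul_cls m n _ rfl f g
        rw [h, lmap_totalCls, lmap_totalCls, lmap_totalCls]
        obtain ⟨hc', h'⟩ := hB.mul_cls m n _ rfl ⟨F m f.val, hF.map_cocycles hπ f.2⟩
          ⟨F n g.val, hF.map_cocycles hπ g.2⟩
        rw [h']
        exact congrArg _ (Subtype.ext (hF.map_cup hπ rfl _ _))
  map_bracket c d := by
    induction c using Multiplication.totalCls_induction with
    | add c c' h h' => simp only [map_add, LinearMap.add_apply, h, h']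
    | hom m f =>
      induction d using Multiplication.totalCls_induction with
      | add d d' h h' => simp only [map_add, h, h']
      | hom n g =>
        -- Two classes of degree 0 have no target degree for their bracket; both brackets vanish by
        -- `bracket_degree_zero`.
        by_cases h0 : m + n = 0
        · obtain ⟨rfl, rfl⟩ : m = 0 ∧ n = 0 := by omega
          rw [lmap_totalCls, lmap_totalCls]
          exact (congrArg _ (A.bracket_degree_zero _ _)).trans
            ((map_zero _).trans (B.bracket_degree_zero _ _).symm)
        · have hk : m + n = (m + n - 1) + 1 := by omega
          obtain ⟨hc, h⟩ := hA.bracket_cls m n _ hk f g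
          rw [h, lmap_totalCls, lmap_totalCls, lmap_totalCls]
          obtain ⟨hc', h'⟩ := hB.bracket_cls m n _ hk ⟨F m f.val, hF.map_cocycles hπ f.2⟩
            ⟨F n g.val, hF.map_cocycles hπ g.2⟩
          rw [h']
          exact congrArg _ (Subtype.ext (hF.map_bracket hk _ _))

end IsOperadHom

/-! ### The sum map from dendriform to Hochschild cochains -/

section Equivariant

variable {K : Type u} [Field K] {G : Type w} [Group G] {V : Type v} [AddCommGroup V] [Module K V]
  (ρ : Representation K G V)

theorem sumMap_isOperadHom : IsOperadHom (dendOperad ρ) (endOperad ρ) (sumMap ρ) where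
  map_one := Subtype.ext (Fin.sum_univ_one _)
  map_comp h i f g := Subtype.ext (sum_dendComp h i f.val g.val)

theorem sumMap_multiplication {ρ : Representation K G V} (D : EquivariantDendriform ρ) :
    sumMap ρ 2 D.multiplication.val = D.toAssociative.multiplication.val :=
  Subtype.ext (Fin.sum_univ_two _)

end Equivariant

end EquivDend

end

open EquivDend in
theorem mainTheorem2 {K G V : Type*} [Field K] [Group G] [Finite G] [AddCommGroup V] [Module K V]
    (ρ : Representation K G V) :
    -- the maps `S_n` form a morphism of operads
    IsOperadHom (dendOperad ρ) (endOperad ρ) (sumMap ρ) ∧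
    ∀ D : EquivariantDendriform ρ,
      -- they preserve the multiplications
      sumMap ρ 2 D.multiplication.val = D.toAssociative.multiplication.val ∧
      -- the two cochain complexes, and `S` as a map of complexes
      (∀ n f, D.multiplication.delta (n + 1) (D.multiplication.delta n f) = 0) ∧
      (∀ n f, D.toAssociative.multiplication.delta (n + 1)
        (D.toAssociative.multiplication.delta n f) = 0) ∧
      (∀ n f, sumMap ρ (n + 1) (D.multiplication.delta n f)
        = D.toAssociative.multiplication.delta n (sumMap ρ n f)) ∧
      -- the Gerstenhaber algebras and the induced map `S_*` between them
      ∃ (A : GerstenhaberAlgebra K D.equivariantCohomology)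
        (B : GerstenhaberAlgebra K D.toAssociative.hochschildCohomology)
        (φ : ∀ n, D.equivariantCohomology n →ₗ[K] D.toAssociative.hochschildCohomology n),
        A.IsInducedBy ∧ B.IsInducedBy ∧
        (∀ (n : ℕ) (f : D.multiplication.cocycles n),
          ∃ hc : sumMap ρ n f.val ∈ D.toAssociative.multiplication.cocycles n,
            φ n (D.multiplication.cls n f)
              = D.toAssociative.multiplication.cls n ⟨sumMap ρ n f.val, hc⟩) ∧
        A.IsHom B φ := by
  refine ⟨sumMap_isOperadHom ρ, fun D => ?_⟩
  have hS := sumMap_isOperadHom ρ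
  have hπ := sumMap_multiplication D
  have hA := D.multiplication.gerstenhaberAlgebra_isInducedBy
  have hB := D.toAssociative.multiplication.gerstenhaberAlgebra_isInducedBy
  exact ⟨hπ, D.multiplication.delta_delta, D.toAssociative.multiplication.delta_delta,
    hS.map_delta hπ, _, _, hS.cohomologyMap hπ, hA, hB,
    fun n f => ⟨hS.map_cocycles hπ f.2, hS.cohomologyMap_cls hπ n f⟩, hS.isHom hπ hA hB⟩
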